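/- An asymptotic couple is a pair $(\Gamma,\psi)$ of a (totally) ordered abelian group $\Gamma$ and a map $\psi:\Gamma\setminus\{0\}\to\Gamma$ such that for all nonzero $\alpha,\beta$: $\psi(\alpha+\beta)\ge\min(\psi(\alpha),\psi(\beta))$ if $\alpha+\beta\neq 0$; $\psi(r\alpha)=\psi(\alpha)$ for all nonzero integers $r$; and $\alpha+\psi(\alpha)>\psi(\beta)$ if $\alpha>0$. It is of $H$-type if $0<\alpha\le\beta$ implies $\psi(\alpha)\ge\psi(\beta)$, it is divisible if $\Gamma$ is divisible, and it has asymptotic integration if every $\alpha\in\Gamma$ equals $\beta+\psi(\beta)$ for some (necessarily unique) $\beta\neq 0$, denoted $\int\alpha$. In that case put $s\alpha:=\psi(\int\alpha)$, and write $\Psi:=\psi(\Gamma\setminus\{0\})$. Let $L=\{0,+,-,<,\psi,\infty,s,p,\delta_1,\delta_2,\delta_3,\dots\}$, with constants $0,\infty$, a binary function symbol $+$, unary function symbols $-,\psi,s,p,\delta_n$ ($n\ge 1$), and a binary relation symbol $<$. Let $T_{\log}$ be the $L$-theory whose models are the divisible asymptotic couples $(\Gamma,\psi)$ of $H$-type with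 asymptotic integration such that $\Psi$ has least element $s0>0$, each $\alpha\in\Psi$ has the immediate successor $s\alpha$ in $\Psi$, and $\alpha\mapsto s\alpha$ is a bijection $\Psi\to\Psi^{>s0}:=\{\beta\in\Psi:\beta>s0\}$. Such a couple is viewed as an $L$-structure with underlying set $\Gamma\cup\{\infty\}$, $\Gamma<\infty$, where $\delta_n$ is division by $n$, $p$ is the inverse $\Psi^{>s0}\to\Psi$ of $s$ on $\Psi^{>s0}$ and takes the value $\infty$ elsewhere, $\psi(0)=\infty$, and every operation takes the value $\infty$ as soon as an argument is $\infty$. **Theorem.** Let $(\Gamma_1,\psi_1)$ and $(\Gamma^*,\psi^*)$ be models of $T_{\log}$, let $(\Gamma_0,\psi_0)\subsetneq(\Gamma_1,\psi_1)$ be a proper $L$-substructure that is a model of $T_{\log}$, suppose that $(\Gamma^*,\psi^*)$ is $|\Gamma_1|^+$-saturated, and let $i:(\Gamma_0,\psi_0)\to(\Gamma^*,\psi^*)$ be an embedding of $L$-structures. Then there are an element $\alpha\in\Gamma_1\setminus\Gamma_0$ and a model $(\Gamma,\psi)$ of $T_{\log}$ with $(\Gamma_0,\psi_0)\subseteq(\Gamma,\psi)\subseteq(\Gamma_1,\psi_1)$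 as $L$-structures and $\alpha\in\Gamma$, such that $i$ extends to an embedding $(\Gamma,\psi)\to(\Gamma^*,\psi^*)$ of $L$-structures. -/

import Mathlib

open FirstOrder Cardinal

set_option linter.unusedSectionVars false

noncomputable section

namespace LogCouple

universe u v

/-! ### Asymptotic couples -/

section Couples

variable {Γ : Type u} [AddCommGroup Γ] [LinearOrder Γ] [IsOrderedAddMonoid Γ]

/-- `(Γ, ψ)` is an asymptotic couple.  The map `ψ : Γ∖{0} → Γ` is extended to `Γ` by
`ψ 0 = ∞`, where `∞` is the top element of `WithTop Γ`. -/
structure IsAsymptoticCouple (ψ : Γ → WithTop Γ) : Prop where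
  psi_eq_top_iff : ∀ α : Γ, ψ α = ⊤ ↔ α = 0
  ac1 : ∀ α β : Γ, α ≠ 0 → β ≠ 0 → α + β ≠ 0 → min (ψ α) (ψ β) ≤ ψ (α + β)
  ac2 : ∀ α : Γ, α ≠ 0 → ∀ r : ℤ, r ≠ 0 → ψ (r • α) = ψ α
  ac3 : ∀ α β : Γ, α ≠ 0 → β ≠ 0 → 0 < α → ψ β < (α : WithTop Γ) + ψ α

/-- `(Γ, ψ)` is an asymptotic couple of `H`-type. -/
structure IsHAsymptoticCouple (ψ : Γ → WithTop Γ) : Prop extends IsAsymptoticCouple ψ where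
  hc : ∀ α β : Γ, 0 < α → α ≤ β → ψ β ≤ ψ α

/-- The set `Ψ = ψ(Γ∖{0})`, as a subset of `Γ ∪ {∞}`. -/
def Psi (ψ : Γ → WithTop Γ) : Set (WithTop Γ) := ψ '' {0}ᶜ

/-- `(Γ, ψ)` has asymptotic integration: every `α` is `β' = β + ψ β` for some `β ≠ 0`. -/
def HasAsymptoticIntegration (ψ : Γ → WithTop Γ) : Prop :=
  ∀ α : Γ, ∃ β : Γ, β ≠ 0 ∧ (β : WithTop Γ) + ψ β = α

/-- The integral `∫ α`: the element `β ≠ 0` with `β + ψ β = α`. -/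
def integral (ψ : Γ → WithTop Γ) (α : Γ) : Γ :=
  Classical.epsilon fun β : Γ => β ≠ 0 ∧ (β : WithTop Γ) + ψ β = α

/-- The value `∞` at `∞` for a function on `Γ`. -/
def extendTop (f : Γ → WithTop Γ) : WithTop Γ → WithTop Γ :=
  WithTop.recTopCoe ⊤ f

/-- The successor function `s α = ψ (∫ α)`, with `s ∞ = ∞`. -/
def succ (ψ : Γ → WithTop Γ) : WithTop Γ → WithTop Γ :=
  extendTop fun α => ψ (integral ψ α)

/-- The predecessor function: the inverse of `s : Ψ → {x ∈ Ψ | s 0 < x}`, with the default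
value `∞` outside `{x ∈ Ψ | s 0 < x}`. -/
def pred (ψ : Γ → WithTop Γ) (x : WithTop Γ) : WithTop Γ := by
  classical
  exact if x ∈ Psi ψ ∧ succ ψ (0 : Γ) < x then
    Classical.epsilon fun y : WithTop Γ => y ∈ Psi ψ ∧ succ ψ y = x
  else ⊤

/-- Division by `n ≥ 1`, with the value `∞` at `∞`. -/
def divBy (n : ℕ+) : WithTop Γ → WithTop Γ :=
  extendTop fun α => ((Classical.epsilon fun β : Γ => (n : ℕ) • β = α : Γ) : WithTop Γ)

/-- `(Γ, ψ)` is a divisible `H`-asymptotic couple with asymptotic integration such that `Ψ` has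
the least element `s 0 > 0`, each `α ∈ Ψ` has the immediate successor `s α` in `Ψ`, and `s` is a
bijection from `Ψ` onto `{x ∈ Ψ | s 0 < x}`. -/
structure IsLogCouple (ψ : Γ → WithTop Γ) : Prop extends IsHAsymptoticCouple ψ where
  divisible : ∀ n : ℕ, 1 ≤ n → ∀ α : Γ, ∃ β : Γ, n • β = α
  integration : HasAsymptoticIntegration ψ
  least : IsLeast (Psi ψ) (succ ψ (0 : Γ))
  least_pos : ((0 : Γ) : WithTop Γ) < succ ψ (0 : Γ)
  immediate : ∀ α ∈ Psi ψ, succ ψ α ∈ Psi ψ ∧ α < succ ψ α ∧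
    ∀ z ∈ Psi ψ, α < z → succ ψ α ≤ z
  bijection : Set.BijOn (succ ψ) (Psi ψ) {x ∈ Psi ψ | succ ψ (0 : Γ) < x}

end Couples

/-! ### The language `L = {0, +, -, <, ψ, ∞, s, p, δ₁, δ₂, …}` -/

/-- The function symbols. -/
inductive LogFunc : ℕ → Type
  | zero : LogFunc 0
  | infty : LogFunc 0
  | neg : LogFunc 1
  | psi : LogFunc 1
  | succ : LogFunc 1
  | pred : LogFunc 1
  | delta (n : ℕ+) : LogFunc 1
  | add : LogFunc 2

/-- The relation symbol. -/
inductive LogRel : ℕ → Type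
  | lt : LogRel 2

/-- The language of `T_log`. -/
def Llog : FirstOrder.Language.{0, 0} := ⟨LogFunc, LogRel⟩

/-- The `L`-structure with underlying set `Γ ∪ {∞}` of a couple `(Γ, ψ)`. -/
@[reducible] def coupleStructure {Γ : Type u} [AddCommGroup Γ] [LinearOrder Γ]
    (ψ : Γ → WithTop Γ) : Llog.Structure (WithTop Γ) where
  funMap {_} f x := match f, x with
    | .zero, _ => ((0 : Γ) : WithTop Γ)
    | .infty, _ => ⊤
    | .neg, x => extendTop (fun α => ((-α : Γ) : WithTop Γ)) (x 0)
    | .psi, x => extendTop ψ (x 0)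
    | .succ, x => succ ψ (x 0)
    | .pred, x => pred ψ (x 0)
    | .delta n, x => divBy n (x 0)
    | .add, x => x 0 + x 1
  RelMap {_} r x := match r, x with
    | .lt, x => x 0 < x 1

/-! ### Terms and formulas of `L` -/

section TermsAndFormulas

variable {α : Type} {n : ℕ}

instance : Zero (Llog.Term α) := ⟨FirstOrder.Language.Constants.term (L := Llog) LogFunc.zero⟩

instance : Top (Llog.Term α) := ⟨FirstOrder.Language.Constants.term (L := Llog) LogFunc.infty⟩

instance : Add (Llog.Term α) := ⟨FirstOrder.Language.Functions.apply₂ (L := Llog) LogFunc.add⟩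

instance : Neg (Llog.Term α) := ⟨FirstOrder.Language.Functions.apply₁ (L := Llog) LogFunc.neg⟩

/-- The term `ψ t`. -/
def psiT (t : Llog.Term α) : Llog.Term α := FirstOrder.Language.Functions.apply₁ (L := Llog) LogFunc.psi t

/-- The term `s t`. -/
def succT (t : Llog.Term α) : Llog.Term α := FirstOrder.Language.Functions.apply₁ (L := Llog) LogFunc.succ t

/-- The term `p t`. -/
def predT (t : Llog.Term α) : Llog.Term α := FirstOrder.Language.Functions.apply₁ (L := Llog) LogFunc.pred t

/-- The term `δ_n t`. -/
def deltaT (k : ℕ+) (t : Llog.Term α) : Llog.Term α :=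
  FirstOrder.Language.Functions.apply₁ (L := Llog) (LogFunc.delta k) t

/-- The term `t + ⋯ + t` with `k` summands. -/
def mulT : ℕ → Llog.Term α → Llog.Term α
  | 0, _ => 0
  | k + 1, t => mulT k t + t

/-- The formula `t₁ < t₂`. -/
def ltF (t₁ t₂ : Llog.Term (Empty ⊕ Fin n)) : Llog.BoundedFormula Empty n :=
  FirstOrder.Language.Relations.boundedFormula₂ (L := Llog) LogRel.lt t₁ t₂

/-- The formula `t₁ ≤ t₂`. -/
def leF (t₁ t₂ : Llog.Term (Empty ⊕ Fin n)) : Llog.BoundedFormula Empty n :=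
  ltF t₁ t₂ ⊔ t₁ =' t₂

/-- The formula `t ≠ ∞`. -/
def finF (t : Llog.Term (Empty ⊕ Fin n)) : Llog.BoundedFormula Empty n := ∼(t =' ⊤)

/-- The formula `t ≠ 0 ∧ t ≠ ∞`. -/
def nzF (t : Llog.Term (Empty ⊕ Fin n)) : Llog.BoundedFormula Empty n := ∼(t =' 0) ⊓ ∼(t =' ⊤)

/-- The formula `t ≠ ∞ ∧ (t = s 0 ∨ t = s (p t))`, which expresses `t ∈ Ψ`. -/
def inPsiF (t : Llog.Term (Empty ⊕ Fin n)) : Llog.BoundedFormula Empty n :=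
  finF t ⊓ (t =' succT 0 ⊔ t =' succT (predT t))

end TermsAndFormulas

/-- Names for the axioms of `T_log`. -/
inductive LogAx : Type
  | ltIrrefl | ltTrans | ltTotal | ltTop
  | zeroFin | addFin | negFin | addAssoc | addComm | zeroAdd | addNeg | addLt
  | addTop | negTop
  | delta (n : ℕ+)
  | psiZero | psiTop | psiFin | ac1 | ac2Neg | ac2 (n : ℕ+) | ac3 | hc
  | succTop | succFin | integration
  | leastPos | least | ltSucc | immediate
  | psiInPsi | predOn

/-- The axioms of `T_log`, as universal sentences. -/
def LogAx.sentence : LogAx → Llog.Sentence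
  | .ltIrrefl => ∀' ∼(ltF (&0) (&0))
  | .ltTrans => ∀' ∀' ∀' (ltF (&0) (&1) ⟹ ltF (&1) (&2) ⟹ ltF (&0) (&2))
  | .ltTotal => ∀' ∀' (ltF (&0) (&1) ⊔ (&0) =' (&1) ⊔ ltF (&1) (&0))
  | .ltTop => ∀' (finF (&0) ⟹ ltF (&0) ⊤)
  | .zeroFin => finF 0
  | .addFin => ∀' ∀' (finF (&0) ⟹ finF (&1) ⟹ finF (&0 + &1))
  | .negFin => ∀' (finF (&0) ⟹ finF (-(&0)))
  | .addAssoc => ∀' ∀' ∀' ((&0 + &1 + &2) =' (&0 + (&1 + &2)))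
  | .addComm => ∀' ∀' ((&0 + &1) =' (&1 + &0))
  | .zeroAdd => ∀' ((0 + &0) =' (&0))
  | .addNeg => ∀' (finF (&0) ⟹ (&0 + -(&0)) =' 0)
  | .addLt => ∀' ∀' ∀' (finF (&2) ⟹ ltF (&0) (&1) ⟹ ltF (&0 + &2) (&1 + &2))
  | .addTop => ∀' ((&0 + ⊤) =' ⊤)
  | .negTop => (-⊤) =' ⊤
  | .delta n => ∀' (mulT n (deltaT n (&0)) =' (&0))
  | .psiZero => psiT 0 =' ⊤
  | .psiTop => psiT ⊤ =' ⊤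
  | .psiFin => ∀' (nzF (&0) ⟹ finF (psiT (&0)))
  | .ac1 => ∀' ∀' (nzF (&0) ⟹ nzF (&1) ⟹ nzF (&0 + &1) ⟹
      (leF (psiT (&0)) (psiT (&0 + &1)) ⊔ leF (psiT (&1)) (psiT (&0 + &1))))
  | .ac2Neg => ∀' (psiT (-(&0)) =' psiT (&0))
  | .ac2 n => ∀' (psiT (mulT n (&0)) =' psiT (&0))
  | .ac3 => ∀' ∀' (nzF (&0) ⟹ nzF (&1) ⟹ ltF 0 (&0) ⟹ ltF (psiT (&1)) (&0 + psiT (&0)))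
  | .hc => ∀' ∀' (ltF 0 (&0) ⟹ leF (&0) (&1) ⟹ finF (&1) ⟹ leF (psiT (&1)) (psiT (&0)))
  | .succTop => succT ⊤ =' ⊤
  | .succFin => ∀' (finF (&0) ⟹ finF (succT (&0)))
  | .integration => ∀' (psiT (&0 + -(succT (&0))) =' succT (&0))
  | .leastPos => ltF 0 (succT 0)
  | .least => ∀' (nzF (&0) ⟹ leF (succT 0) (psiT (&0)))
  | .ltSucc => ∀' (nzF (&0) ⟹ ltF (psiT (&0)) (succT (psiT (&0))))
  | .immediate => ∀' ∀' (nzF (&0) ⟹ nzF (&1) ⟹ ltF (psiT (&0)) (psiT (&1)) ⟹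
      leF (succT (psiT (&0))) (psiT (&1)))
  | .psiInPsi => ∀' (nzF (&0) ⟹ inPsiF (psiT (&0)))
  | .predOn => ∀' (finF (predT (&0)) ⟹
      ((&0) =' succT (predT (&0)) ⊓ inPsiF (predT (&0)) ⊓ ltF (succT 0) (&0)))

/-- The theory `T_log`.  Its models are exactly the `L`-structures of the couples satisfying
`IsLogCouple`; this is proved as `models_Tlog_iff` below. -/
def Tlog : Llog.Theory := Set.range LogAx.sentence
/-! ### The models of `T_log` are the couples -/

section Models

open FirstOrder.Language FirstOrder.Language.Structure

variable (M : Type u) [Llog.Structure M]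

/-- The interpretation of `0` in a structure. -/
def zeroM : M := funMap (L := Llog) LogFunc.zero (default : Fin 0 → M)

/-- The interpretation of `∞` in a structure. -/
def topM : M := funMap (L := Llog) LogFunc.infty (default : Fin 0 → M)

variable {M}

/-- The interpretation of `+` in a structure. -/
def addM (x y : M) : M := funMap (L := Llog) LogFunc.add ![x, y]

/-- The interpretation of `-` in a structure. -/
def negM (x : M) : M := funMap (L := Llog) LogFunc.neg ![x]

/-- The interpretation of `ψ` in a structure. -/
def psiM (x : M) : M := funMap (L := Llog) LogFunc.psi ![x]

/-- The interpretation of `s` in a structure. -/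
def succM (x : M) : M := funMap (L := Llog) LogFunc.succ ![x]

/-- The interpretation of `p` in a structure. -/
def predM (x : M) : M := funMap (L := Llog) LogFunc.pred ![x]

/-- The interpretation of `δ_n` in a structure. -/
def deltaM (n : ℕ+) (x : M) : M := funMap (L := Llog) (LogFunc.delta n) ![x]

/-- The interpretation of `<` in a structure. -/
def ltM (x y : M) : Prop := RelMap (L := Llog) LogRel.lt ![x, y]

/-- The sum of `n` copies of `x` in a structure. -/
def mulM : ℕ → M → M
  | 0, _ => zeroM M
  | k + 1, x => addM (mulM k x) x

/-- The condition that `inPsiF` expresses. -/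
def inPsiM (x : M) : Prop := x ≠ topM M ∧ (x = succM (zeroM M) ∨ x = succM (predM x))

section

variable {α : Type} {n : ℕ} (v : α → M) (t t₁ t₂ : Llog.Term α)

theorem realize_zero : (0 : Llog.Term α).realize v = zeroM M :=
  Term.realize_constants

theorem realize_top : (⊤ : Llog.Term α).realize v = topM M :=
  Term.realize_constants

theorem realize_add : (t₁ + t₂).realize v = addM (t₁.realize v) (t₂.realize v) :=
  Term.realize_functions_apply₂

theorem realize_neg : (-t).realize v = negM (t.realize v) :=
  Term.realize_functions_apply₁

theorem realize_psiT : (psiT t).realize v = psiM (t.realize v) :=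
  Term.realize_functions_apply₁

theorem realize_succT : (succT t).realize v = succM (t.realize v) :=
  Term.realize_functions_apply₁

theorem realize_predT : (predT t).realize v = predM (t.realize v) :=
  Term.realize_functions_apply₁

theorem realize_deltaT (k : ℕ+) : (deltaT k t).realize v = deltaM k (t.realize v) :=
  Term.realize_functions_apply₁

theorem realize_mulT (k : ℕ) : (mulT k t).realize v = mulM k (t.realize v) := by
  induction k with
  | zero => exact realize_zero v
  | succ k ih => rw [mulT, realize_add, ih, mulM]

end

section

variable {n : ℕ} (v : Empty → M) (xs : Fin n → M) (t t₁ t₂ : Llog.Term (Empty ⊕ Fin n))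

theorem realize_ltF : (ltF t₁ t₂).Realize v xs ↔
    ltM (t₁.realize (Sum.elim v xs)) (t₂.realize (Sum.elim v xs)) :=
  BoundedFormula.realize_rel₂

theorem realize_leF : (leF t₁ t₂).Realize v xs ↔
    (ltM (t₁.realize (Sum.elim v xs)) (t₂.realize (Sum.elim v xs)) ∨
      t₁.realize (Sum.elim v xs) = t₂.realize (Sum.elim v xs)) := by
  simp [leF, realize_ltF]

theorem realize_finF : (finF t).Realize v xs ↔ t.realize (Sum.elim v xs) ≠ topM M := by
  simp [finF, realize_top]

theorem realize_nzF : (nzF t).Realize v xs ↔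
    (t.realize (Sum.elim v xs) ≠ zeroM M ∧ t.realize (Sum.elim v xs) ≠ topM M) := by
  simp [nzF, realize_top, realize_zero]

theorem realize_inPsiF : (inPsiF t).Realize v xs ↔ inPsiM (t.realize (Sum.elim v xs)) := by
  simp [inPsiF, inPsiM, realize_finF, realize_zero, realize_succT, realize_predT]

end

variable (M) in
/-- The content of an axiom in a structure. -/
def LogAx.toProp : LogAx → Prop
  | .ltIrrefl => ∀ x : M, ¬ ltM x x
  | .ltTrans => ∀ x y z : M, ltM x y → ltM y z → ltM x z
  | .ltTotal => ∀ x y : M, (ltM x y ∨ x = y) ∨ ltM y x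
  | .ltTop => ∀ x : M, x ≠ topM M → ltM x (topM M)
  | .zeroFin => zeroM M ≠ topM M
  | .addFin => ∀ x y : M, x ≠ topM M → y ≠ topM M → addM x y ≠ topM M
  | .negFin => ∀ x : M, x ≠ topM M → negM x ≠ topM M
  | .addAssoc => ∀ x y z : M, addM (addM x y) z = addM x (addM y z)
  | .addComm => ∀ x y : M, addM x y = addM y x
  | .zeroAdd => ∀ x : M, addM (zeroM M) x = x
  | .addNeg => ∀ x : M, x ≠ topM M → addM x (negM x) = zeroM M
  | .addLt => ∀ x y z : M, z ≠ topM M → ltM x y → ltM (addM x z) (addM y z)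
  | .addTop => ∀ x : M, addM x (topM M) = topM M
  | .negTop => negM (topM M) = topM M
  | .delta n => ∀ x : M, mulM n (deltaM n x) = x
  | .psiZero => psiM (zeroM M) = topM M
  | .psiTop => psiM (topM M) = topM M
  | .psiFin => ∀ x : M, (x ≠ zeroM M ∧ x ≠ topM M) → psiM x ≠ topM M
  | .ac1 => ∀ x y : M, (x ≠ zeroM M ∧ x ≠ topM M) → (y ≠ zeroM M ∧ y ≠ topM M) →
      (addM x y ≠ zeroM M ∧ addM x y ≠ topM M) →
      ((ltM (psiM x) (psiM (addM x y)) ∨ psiM x = psiM (addM x y)) ∨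
        (ltM (psiM y) (psiM (addM x y)) ∨ psiM y = psiM (addM x y)))
  | .ac2Neg => ∀ x : M, psiM (negM x) = psiM x
  | .ac2 n => ∀ x : M, psiM (mulM n x) = psiM x
  | .ac3 => ∀ x y : M, (x ≠ zeroM M ∧ x ≠ topM M) → (y ≠ zeroM M ∧ y ≠ topM M) →
      ltM (zeroM M) x → ltM (psiM y) (addM x (psiM x))
  | .hc => ∀ x y : M, ltM (zeroM M) x → (ltM x y ∨ x = y) → y ≠ topM M →
      (ltM (psiM y) (psiM x) ∨ psiM y = psiM x)
  | .succTop => succM (topM M) = topM M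
  | .succFin => ∀ x : M, x ≠ topM M → succM x ≠ topM M
  | .integration => ∀ x : M, psiM (addM x (negM (succM x))) = succM x
  | .leastPos => ltM (zeroM M) (succM (zeroM M))
  | .least => ∀ x : M, (x ≠ zeroM M ∧ x ≠ topM M) →
      (ltM (succM (zeroM M)) (psiM x) ∨ succM (zeroM M) = psiM x)
  | .ltSucc => ∀ x : M, (x ≠ zeroM M ∧ x ≠ topM M) → ltM (psiM x) (succM (psiM x))
  | .immediate => ∀ x y : M, (x ≠ zeroM M ∧ x ≠ topM M) → (y ≠ zeroM M ∧ y ≠ topM M) →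
      ltM (psiM x) (psiM y) →
      (ltM (succM (psiM x)) (psiM y) ∨ succM (psiM x) = psiM y)
  | .psiInPsi => ∀ x : M, (x ≠ zeroM M ∧ x ≠ topM M) → inPsiM (psiM x)
  | .predOn => ∀ x : M, predM x ≠ topM M →
      ((x = succM (predM x) ∧ inPsiM (predM x)) ∧ ltM (succM (zeroM M)) x)

theorem LogAx.realize_iff (a : LogAx) : M ⊨ a.sentence ↔ a.toProp M := by
  cases a <;>
  simp only [LogAx.sentence, LogAx.toProp, Sentence.Realize, Formula.Realize,
    BoundedFormula.realize_all, BoundedFormula.realize_imp, BoundedFormula.realize_not,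
    BoundedFormula.realize_inf, BoundedFormula.realize_sup, BoundedFormula.realize_bdEqual,
    realize_ltF, realize_leF, realize_finF, realize_nzF, realize_inPsiF,
    realize_zero, realize_top, realize_add, realize_neg, realize_psiT, realize_succT,
    realize_predT, realize_deltaT, realize_mulT] <;> rfl

theorem model_Tlog_iff_toProp : M ⊨ Tlog ↔ ∀ a : LogAx, a.toProp M := by
  rw [Theory.model_iff]
  constructor
  · exact fun h a => a.realize_iff.1 (h _ ⟨a, rfl⟩)
  · rintro h _ ⟨a, rfl⟩
    exact a.realize_iff.2 (h a)


end Models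

section Couples

variable {Γ : Type u} [AddCommGroup Γ] [LinearOrder Γ] [IsOrderedAddMonoid Γ]
  {ψ : Γ → WithTop Γ}

theorem IsAsymptoticCouple.exists_coe (h : IsAsymptoticCouple ψ) {α : Γ} (hα : α ≠ 0) :
    ∃ b : Γ, ψ α = b := by
  obtain ⟨b, hb⟩ := WithTop.ne_top_iff_exists.1 (mt (h.psi_eq_top_iff α).1 hα)
  exact ⟨b, hb.symm⟩

/-- An element has at most one integral. -/
theorem IsAsymptoticCouple.integral_unique (h : IsAsymptoticCouple ψ) {α β : Γ}
    (hα : α ≠ 0) (hβ : β ≠ 0) (e : (α : WithTop Γ) + ψ α = β + ψ β) : α = β := by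
  wlog hlt : α < β generalizing α β with H
  · rcases lt_trichotomy α β with h1 | h1 | h1
    · exact H hα hβ e h1
    · exact h1
    · exact (H hβ hα e.symm h1).symm
  exfalso
  obtain ⟨a, ha⟩ := h.exists_coe hα
  obtain ⟨b, hb⟩ := h.exists_coe hβ
  have hγ : β - α ≠ 0 := sub_ne_zero.2 hlt.ne'
  have hpos : 0 < β - α := sub_pos.2 hlt
  obtain ⟨c, hc⟩ := h.exists_coe hγ
  have hab : α + a = β + b := by
    rw [ha, hb] at e
    exact_mod_cast e
  have hba : b < a := by
    by_contra hh
    exact absurd hab (add_lt_add_of_lt_of_le hlt (not_lt.1 hh)).ne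
  have hneg : ψ (-α) = a := by
    have := h.ac2 α hα (-1) (by decide)
    rw [neg_one_zsmul] at this
    rw [this, ha]
  have hneg' : ψ (-(β - α)) = c := by
    have := h.ac2 _ hγ (-1) (by decide)
    rw [neg_one_zsmul] at this
    rw [this, hc]
  have h3 := h.ac1 α (β - α) hα hγ (by simpa using hβ)
  rw [add_sub_cancel, ha, hb, hc] at h3
  have hcb : c ≤ b := by
    have h3' : min a c ≤ b := by exact_mod_cast h3
    rcases min_le_iff.1 h3' with h5 | h5
    · exact absurd h5 (not_le.2 hba)
    · exact h5
  have h4 := h.ac3 (β - α) α hγ hα hpos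
  rw [ha, hc] at h4
  have h4' : a < β - α + c := by exact_mod_cast h4
  have h5 : a < β - α + b := lt_of_lt_of_le h4' (by gcongr)
  have h6 : α + a < α + (β - α + b) := by gcongr
  rw [hab] at h6
  apply h6.ne
  abel

theorem integral_spec (hi : HasAsymptoticIntegration ψ) (α : Γ) :
    integral ψ α ≠ 0 ∧ ((integral ψ α : Γ) : WithTop Γ) + ψ (integral ψ α) = α :=
  Classical.epsilon_spec (hi α)

theorem IsAsymptoticCouple.integral_eq (h : IsAsymptoticCouple ψ) {α β : Γ} (hβ : β ≠ 0)
    (e : (β : WithTop Γ) + ψ β = α) : integral ψ α = β := by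
  have hs : integral ψ α ≠ 0 ∧ ((integral ψ α : Γ) : WithTop Γ) + ψ (integral ψ α) = α :=
    Classical.epsilon_spec (p := fun β : Γ => β ≠ 0 ∧ (β : WithTop Γ) + ψ β = α) ⟨β, hβ, e⟩
  exact h.integral_unique hs.1 hβ (hs.2.trans e.symm)

theorem extendTop_coe (f : Γ → WithTop Γ) (α : Γ) : extendTop f α = f α := rfl

theorem extendTop_top (f : Γ → WithTop Γ) : extendTop f ⊤ = ⊤ := rfl

theorem succ_coe (α : Γ) : succ ψ α = ψ (integral ψ α) := rfl

theorem IsLogCouple.succ_spec (h : IsLogCouple ψ) (α : Γ) :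
    ∃ b : Γ, succ ψ α = b ∧ α - b ≠ 0 ∧ ψ (α - b) = b := by
  have hs := integral_spec h.integration α
  obtain ⟨b, hb⟩ := h.exists_coe hs.1
  have e : integral ψ α + b = α := by
    have := hs.2
    rw [hb] at this
    exact_mod_cast this
  have e' : α - b = integral ψ α := sub_eq_of_eq_add e.symm
  exact ⟨b, hb, e' ▸ hs.1, e' ▸ hb⟩

theorem IsLogCouple.pred_spec (h : IsLogCouple ψ) {x : WithTop Γ} (hx : x ∈ Psi ψ)
    (hlt : succ ψ (0 : Γ) < x) : pred ψ x ∈ Psi ψ ∧ succ ψ (pred ψ x) = x := by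
  obtain ⟨y, hy⟩ := h.bijection.surjOn ⟨hx, hlt⟩
  rw [pred, if_pos ⟨hx, hlt⟩]
  exact Classical.epsilon_spec (p := fun y : WithTop Γ => y ∈ Psi ψ ∧ succ ψ y = x) ⟨y, hy⟩

theorem IsLogCouple.inPsi (h : IsLogCouple ψ) {x : WithTop Γ} (hx : x ∈ Psi ψ) :
    x ≠ ⊤ ∧ (x = succ ψ (0 : Γ) ∨ x = succ ψ (pred ψ x)) := by
  constructor
  · obtain ⟨α, hα, rfl⟩ := hx
    exact mt (h.psi_eq_top_iff α).1 hα
  · rcases (h.least.2 hx).eq_or_lt with e | hlt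
    · exact Or.inl e.symm
    · exact Or.inr (h.pred_spec hx hlt).2.symm

theorem divBy_spec (hd : ∀ n : ℕ, 1 ≤ n → ∀ α : Γ, ∃ β : Γ, n • β = α) (n : ℕ+) (α : Γ) :
    ∃ β : Γ, divBy n (α : WithTop Γ) = β ∧ (n : ℕ) • β = α :=
  ⟨_, rfl, Classical.epsilon_spec (hd n n.2 α)⟩

theorem divBy_eq {n : ℕ+} {α β : Γ} (e : (n : ℕ) • β = α) :
    divBy n (α : WithTop Γ) = β := by
  have hs : (n : ℕ) • (Classical.epsilon fun β : Γ => (n : ℕ) • β = α) = α :=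
    Classical.epsilon_spec (p := fun β : Γ => (n : ℕ) • β = α) ⟨β, e⟩
  have : (Classical.epsilon fun β : Γ => (n : ℕ) • β = α) = β :=
    nsmul_right_injective n.ne_zero (hs.trans e.symm)
  exact congrArg _ this

theorem mulM_coe (ψ : Γ → WithTop Γ) (n : ℕ) (α : Γ) :
    letI := coupleStructure ψ
    mulM n (α : WithTop Γ) = ((n • α : Γ) : WithTop Γ) := by
  induction n with
  | zero => simp only [zero_smul]; rfl
  | succ n ih =>
    simp only [mulM, ih, succ_nsmul]
    rfl

theorem mulM_top (ψ : Γ → WithTop Γ) (n : ℕ+) :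
    letI := coupleStructure ψ
    mulM n (⊤ : WithTop Γ) = ⊤ := by
  obtain ⟨k, hk⟩ := Nat.exists_eq_succ_of_ne_zero n.ne_zero
  rw [hk]
  exact WithTop.add_top _

/-- The `L`-structure of a couple satisfying `IsLogCouple` is a model of `T_log`. -/
theorem IsLogCouple.model (h : IsLogCouple ψ) :
    letI := coupleStructure ψ
    WithTop Γ ⊨ Tlog := by
  let := coupleStructure ψ
  rw [model_Tlog_iff_toProp]
  have hz : zeroM (WithTop Γ) = ((0 : Γ) : WithTop Γ) := rfl
  have ht : topM (WithTop Γ) = ⊤ := rfl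
  have ha : ∀ x y : WithTop Γ, addM x y = x + y := fun _ _ => rfl
  have hn : ∀ x : Γ, negM (x : WithTop Γ) = ((-x : Γ) : WithTop Γ) := fun _ => rfl
  have hnt : negM (⊤ : WithTop Γ) = ⊤ := rfl
  have hp : ∀ x : Γ, psiM (x : WithTop Γ) = ψ x := fun _ => rfl
  have hpt : psiM (⊤ : WithTop Γ) = ⊤ := rfl
  have hs : ∀ x : WithTop Γ, succM x = succ ψ x := fun _ => rfl
  have hst : succ ψ ⊤ = ⊤ := rfl
  have hpr : ∀ x : WithTop Γ, predM x = pred ψ x := fun _ => rfl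
  have hd : ∀ (n : ℕ+) (x : WithTop Γ), deltaM n x = divBy n x := fun _ _ => rfl
  have hlt : ∀ x y : WithTop Γ, ltM x y ↔ x < y := fun _ _ => Iff.rfl
  have hle : ∀ x y : WithTop Γ, (x < y ∨ x = y) ↔ x ≤ y := fun _ _ => le_iff_lt_or_eq.symm
  have hnz : ∀ x : WithTop Γ, (x ≠ ((0 : Γ) : WithTop Γ) ∧ x ≠ ⊤) →
      ∃ α : Γ, x = α ∧ α ≠ 0 := by
    rintro x ⟨h1, h2⟩
    obtain ⟨α, rfl⟩ := WithTop.ne_top_iff_exists.1 h2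
    exact ⟨α, rfl, fun e => h1 (by rw [e])⟩
  have hmem : ∀ α : Γ, α ≠ 0 → ψ α ∈ Psi ψ := fun α hα => ⟨α, hα, rfl⟩
  have hin : ∀ x : WithTop Γ, inPsiM x ↔
      (x ≠ ⊤ ∧ (x = succ ψ (0 : Γ) ∨ x = succ ψ (pred ψ x))) := fun _ => Iff.rfl
  intro a
  cases a <;>
    simp only [LogAx.toProp, hz, ht, ha, hs, hst, hpr, hd, hlt, hle, hin, hnt, hpt]
  case ltIrrefl => exact fun x => lt_irrefl x
  case ltTrans => exact fun x y z => lt_trans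
  case ltTotal =>
    intro x y
    rcases lt_trichotomy x y with h1 | h1 | h1
    · exact Or.inl h1.le
    · exact Or.inl h1.le
    · exact Or.inr h1
  case ltTop => exact fun x hx => lt_top_iff_ne_top.2 hx
  case zeroFin => exact WithTop.coe_ne_top
  case addFin => exact fun x y hx hy => WithTop.add_ne_top.2 ⟨hx, hy⟩
  case negFin =>
    intro x hx
    obtain ⟨α, rfl⟩ := WithTop.ne_top_iff_exists.1 hx
    exact WithTop.coe_ne_top
  case addAssoc => exact add_assoc
  case addComm => exact add_comm
  case zeroAdd => exact zero_add
  case addNeg =>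
    intro x hx
    obtain ⟨α, rfl⟩ := WithTop.ne_top_iff_exists.1 hx
    rw [hn, ← WithTop.coe_add, add_neg_cancel]
  case addLt => exact fun x y z hz hxy => WithTop.add_lt_add_right hz hxy
  case addTop => exact WithTop.add_top
  case delta n =>
    intro x
    induction x using WithTop.recTopCoe with
    | top => exact mulM_top ψ n
    | coe α =>
      obtain ⟨β, e1, e2⟩ := divBy_spec h.divisible n α
      rw [e1, mulM_coe, e2]
  case psiZero => exact (h.psi_eq_top_iff 0).2 rfl
  case psiFin =>
    intro x hx
    obtain ⟨α, rfl, hα⟩ := hnz x hx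
    exact mt (h.psi_eq_top_iff α).1 hα
  case ac1 =>
    intro x y hx hy hxy
    obtain ⟨α, rfl, hα⟩ := hnz x hx
    obtain ⟨β, rfl, hβ⟩ := hnz y hy
    rw [← WithTop.coe_add, hp, hp, hp]
    refine min_le_iff.1 (h.ac1 α β hα hβ fun e => hxy.1 ?_)
    rw [← WithTop.coe_add, e]
  case ac2Neg =>
    intro x
    induction x using WithTop.recTopCoe with
    | top => rfl
    | coe α =>
      rw [hn, hp, hp]
      rcases eq_or_ne α 0 with rfl | hα
      · rw [neg_zero]
      · rw [← neg_one_zsmul]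
        exact h.ac2 α hα (-1) (by decide)
  case ac2 n =>
    intro x
    induction x using WithTop.recTopCoe with
    | top => rw [mulM_top]
    | coe α =>
      rw [mulM_coe, hp, hp]
      rcases eq_or_ne α 0 with rfl | hα
      · rw [smul_zero]
      · rw [← natCast_zsmul]
        exact h.ac2 α hα n (by exact_mod_cast n.ne_zero)
  case ac3 =>
    intro x y hx hy hpos
    obtain ⟨α, rfl, hα⟩ := hnz x hx
    obtain ⟨β, rfl, hβ⟩ := hnz y hy
    exact h.ac3 α β hα hβ (by exact_mod_cast hpos)
  case hc =>
    intro x y hx hxy hy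
    obtain ⟨β, rfl⟩ := WithTop.ne_top_iff_exists.1 hy
    obtain ⟨α, rfl⟩ := WithTop.ne_top_iff_exists.1 (hxy.trans_lt (WithTop.coe_lt_top β)).ne
    exact h.hc α β (by exact_mod_cast hx) (by exact_mod_cast hxy)
  case succFin =>
    intro x hx
    obtain ⟨α, rfl⟩ := WithTop.ne_top_iff_exists.1 hx
    obtain ⟨b, hb, -⟩ := h.succ_spec α
    rw [hb]
    exact WithTop.coe_ne_top
  case integration =>
    intro x
    induction x using WithTop.recTopCoe with
    | top => rfl
    | coe α =>
      obtain ⟨b, hb, -, hb'⟩ := h.succ_spec α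
      rw [hb, hn, ← WithTop.coe_add, hp, ← sub_eq_add_neg, hb']
  case leastPos => exact h.least_pos
  case least =>
    intro x hx
    obtain ⟨α, rfl, hα⟩ := hnz x hx
    exact h.least.2 (hmem α hα)
  case ltSucc =>
    intro x hx
    obtain ⟨α, rfl, hα⟩ := hnz x hx
    exact (h.immediate _ (hmem α hα)).2.1
  case immediate =>
    intro x y hx hy hxy
    obtain ⟨α, rfl, hα⟩ := hnz x hx
    obtain ⟨β, rfl, hβ⟩ := hnz y hy
    exact (h.immediate _ (hmem α hα)).2.2 _ (hmem β hβ) hxy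
  case psiInPsi =>
    intro x hx
    obtain ⟨α, rfl, hα⟩ := hnz x hx
    exact h.inPsi (hmem α hα)
  case predOn =>
    intro x hx
    by_cases hc : x ∈ Psi ψ ∧ succ ψ (0 : Γ) < x
    · obtain ⟨h1, h2⟩ := h.pred_spec hc.1 hc.2
      exact ⟨⟨h2.symm, h.inPsi h1⟩, hc.2⟩
    · exact absurd (by rw [pred, if_neg hc]) hx

end Couples

section Converse

open FirstOrder.Language FirstOrder.Language.Structure

/-- A model of `T_log` is the `L`-structure of a couple satisfying `IsLogCouple`. -/
theorem exists_couple {M : Type u} [Llog.Structure M] (h : ∀ a : LogAx, a.toProp M) :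
    ∃ (Γ : Type u) (_ : AddCommGroup Γ) (_ : LinearOrder Γ) (_ : IsOrderedAddMonoid Γ)
      (ψ : Γ → WithTop Γ), IsLogCouple ψ ∧
        Nonempty (@FirstOrder.Language.Equiv Llog M (WithTop Γ) _ (coupleStructure ψ)) := by
  classical
  let Γ : Type u := {x : M // x ≠ topM M}
  have ltIrrefl : ∀ x : M, ¬ ltM x x := h .ltIrrefl
  have ltTrans : ∀ x y z : M, ltM x y → ltM y z → ltM x z := h .ltTrans
  have ltTotal : ∀ x y : M, (ltM x y ∨ x = y) ∨ ltM y x := h .ltTotal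
  have ltTop : ∀ x : M, x ≠ topM M → ltM x (topM M) := h .ltTop
  have addComm : ∀ x y : M, addM x y = addM y x := h .addComm
  have addTop : ∀ x : M, addM x (topM M) = topM M := h .addTop
  let grp : AddGroup Γ :=
    letI : Add Γ := ⟨fun x y => ⟨addM x.1 y.1, h .addFin _ _ x.2 y.2⟩⟩
    letI : Neg Γ := ⟨fun x => ⟨negM x.1, h .negFin _ x.2⟩⟩
    letI : Zero Γ := ⟨⟨zeroM M, h .zeroFin⟩⟩
    AddGroup.ofLeftAxioms (fun x y z => Subtype.ext (h .addAssoc _ _ _))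
      (fun x => Subtype.ext (h .zeroAdd _))
      (fun x => Subtype.ext ((addComm _ _).trans (h .addNeg _ x.2)))
  let cgrp : AddCommGroup Γ :=
    { grp with add_comm := fun x y => Subtype.ext (addComm _ _) }
  have : IsStrictTotalOrder Γ (fun x y => ltM x.1 y.1) :=
    { irrefl := fun x => ltIrrefl _
      trans := fun x y z => ltTrans _ _ _
      trichotomous := fun x y h1 h2 => Subtype.ext (by
        rcases ltTotal x.1 y.1 with (h3 | h3) | h3
        · exact absurd h3 h1
        · exact h3
        · exact absurd h3 h2) }
  let ord : LinearOrder Γ := linearOrderOfSTO (fun x y : Γ => ltM x.1 y.1)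
  have lt_def : ∀ x y : Γ, x < y ↔ ltM x.1 y.1 := fun _ _ => Iff.rfl
  have oam : IsOrderedAddMonoid Γ :=
    { add_le_add_left := fun a b hab c => by
        rcases hab.eq_or_lt with rfl | hlt
        · exact le_rfl
        · exact le_of_lt (h .addLt _ _ _ c.2 hlt) }
  let c : M → WithTop Γ := fun x => if hx : x = topM M then ⊤ else ((⟨x, hx⟩ : Γ) : WithTop Γ)
  have c_top : c (topM M) = ⊤ := dif_pos rfl
  have c_val : ∀ x : Γ, c x.1 = x := fun x => dif_neg x.2
  let d : WithTop Γ → M := WithTop.recTopCoe (topM M) Subtype.val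
  have d_top : d ⊤ = topM M := rfl
  have d_coe : ∀ x : Γ, d x = x.1 := fun _ => rfl
  have cd : ∀ x, c (d x) = x := by
    intro x
    induction x using WithTop.recTopCoe with
    | top => exact c_top
    | coe x => exact c_val x
  have cases_M : ∀ x : M, x = topM M ∨ ∃ y : Γ, x = y.1 := fun x => by
    by_cases hx : x = topM M
    · exact Or.inl hx
    · exact Or.inr ⟨⟨x, hx⟩, rfl⟩
  have dc : ∀ x, d (c x) = x := by
    intro x
    rcases cases_M x with rfl | ⟨y, rfl⟩
    · rw [c_top, d_top]
    · rw [c_val, d_coe]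
  let ψ : Γ → WithTop Γ := fun x => c (psiM x.1)
  have c_inj : Function.Injective c := Function.LeftInverse.injective dc
  have c_eq_top : ∀ x, c x = ⊤ ↔ x = topM M := fun x => by rw [← c_top, c_inj.eq_iff]
  have c_zero : c (zeroM M) = ((0 : Γ) : WithTop Γ) := c_val 0
  have topAdd : ∀ x : M, addM (topM M) x = topM M := fun x => by rw [addComm, addTop]
  have c_add : ∀ x y, c (addM x y) = c x + c y := by
    intro x y
    rcases cases_M x with rfl | ⟨x, rfl⟩
    · rw [topAdd, c_top, WithTop.top_add]
    rcases cases_M y with rfl | ⟨y, rfl⟩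
    · rw [addTop, c_top, WithTop.add_top]
    · exact (c_val (x + y)).trans (by rw [c_val, c_val, WithTop.coe_add])
  have c_lt : ∀ x y, c x < c y ↔ ltM x y := by
    intro x y
    rcases cases_M x with rfl | ⟨x, rfl⟩
    · rw [c_top]
      refine ⟨fun h1 => absurd h1 not_top_lt, fun h1 => ?_⟩
      rcases cases_M y with rfl | ⟨y, rfl⟩
      · exact absurd h1 (ltIrrefl _)
      · exact absurd (ltTrans _ _ _ h1 (ltTop _ y.2)) (ltIrrefl _)
    rcases cases_M y with rfl | ⟨y, rfl⟩
    · rw [c_top, c_val]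
      exact ⟨fun _ => ltTop _ x.2, fun _ => WithTop.coe_lt_top x⟩
    · rw [c_val, c_val, WithTop.coe_lt_coe, lt_def]
  have c_le : ∀ x y, c x ≤ c y ↔ (ltM x y ∨ x = y) := by
    intro x y
    rw [le_iff_lt_or_eq, c_lt, c_inj.eq_iff]
  have c_neg : ∀ x, c (negM x) = extendTop (fun α => ((-α : Γ) : WithTop Γ)) (c x) := by
    intro x
    rcases cases_M x with rfl | ⟨x, rfl⟩
    · rw [h .negTop, c_top, extendTop_top]
    · rw [c_val, extendTop_coe]
      exact c_val (-x)
  have c_psi : ∀ x, c (psiM x) = extendTop ψ (c x) := by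
    intro x
    rcases cases_M x with rfl | ⟨x, rfl⟩
    · rw [h .psiTop, c_top, extendTop_top]
    · rw [c_val, extendTop_coe]
  have nz : ∀ x : Γ, x ≠ 0 → (x.1 ≠ zeroM M ∧ x.1 ≠ topM M) := fun x hx =>
    ⟨fun e => hx (Subtype.ext e), x.2⟩
  have c_mul : ∀ (n : ℕ) (x : Γ), c (mulM n x.1) = ((n • x : Γ) : WithTop Γ) := by
    intro n x
    induction n with
    | zero => rw [zero_smul]; exact c_zero
    | succ n ih => rw [mulM, c_add, ih, c_val, succ_nsmul, WithTop.coe_add]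
  have mul_top : ∀ (n : ℕ+), mulM n (topM M) = topM M := by
    intro n
    obtain ⟨k, hk⟩ := Nat.exists_eq_succ_of_ne_zero n.ne_zero
    rw [hk]
    exact addTop _
  have delta_spec : ∀ (n : ℕ+) (x : Γ), ∃ y : Γ, deltaM n x.1 = y.1 ∧ (n : ℕ) • y = x := by
    intro n x
    have h1 : mulM n (deltaM n x.1) = x.1 := h (.delta n) x.1
    rcases cases_M (deltaM n x.1) with h2 | ⟨y, h2⟩
    · rw [h2, mul_top] at h1
      exact absurd h1.symm x.2
    · refine ⟨y, h2, ?_⟩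
      rw [h2] at h1
      have h3 := c_mul n y
      rw [h1, c_val] at h3
      exact (WithTop.coe_injective h3).symm
  have delta_top : ∀ n : ℕ+, deltaM n (topM M) = topM M := by
    intro n
    have h1 : mulM n (deltaM n (topM M)) = topM M := h (.delta n) (topM M)
    rcases cases_M (deltaM n (topM M)) with h2 | ⟨y, h2⟩
    · exact h2
    · rw [h2, ← c_eq_top, c_mul] at h1
      exact absurd h1 WithTop.coe_ne_top
  have c_delta : ∀ (n : ℕ+) (x : M), c (deltaM n x) = divBy n (c x) := by
    intro n x
    rcases cases_M x with rfl | ⟨x, rfl⟩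
    · rw [delta_top, c_top]
      rfl
    · obtain ⟨y, h1, h2⟩ := delta_spec n x
      rw [h1, c_val, c_val, divBy_eq h2]
  -- the couple
  have hA : IsAsymptoticCouple ψ :=
    { psi_eq_top_iff := fun α => by
        rw [c_eq_top]
        refine ⟨fun e => ?_, ?_⟩
        · by_contra hα
          exact h .psiFin _ (nz α hα) e
        · rintro rfl
          exact h .psiZero
      ac1 := fun α β hα hβ hαβ => by
        rw [min_le_iff, c_le, c_le]
        exact h .ac1 α.1 β.1 (nz α hα) (nz β hβ) (nz _ hαβ)
      ac2 := fun α hα r hr => by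
        have hnat : ∀ n : ℕ, n ≠ 0 → ψ (n • α) = ψ α := by
          intro n hn
          have h1 := c_mul n α
          have h2 : mulM n α.1 = (n • α : Γ).1 := c_inj (h1.trans (c_val _).symm)
          have h3 := h (.ac2 ⟨n, Nat.pos_of_ne_zero hn⟩) α.1
          exact congrArg c ((congrArg psiM h2.symm).trans h3)
        have hneg : ∀ x : Γ, ψ (-x) = ψ x := fun x => congrArg c (h .ac2Neg x.1)
        obtain ⟨n, rfl | rfl⟩ := r.eq_nat_or_neg
        · rw [natCast_zsmul]
          exact hnat n (by exact_mod_cast hr)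
        · rw [neg_smul, natCast_zsmul, hneg]
          exact hnat n (by simpa using hr)
      ac3 := fun α β hα hβ hpos => by
        have h1 := h .ac3 α.1 β.1 (nz α hα) (nz β hβ) hpos
        rw [← c_lt, c_add, c_val] at h1
        exact h1 }
  have hH : IsHAsymptoticCouple ψ :=
    { hA with
      hc := fun α β hα hαβ => by
        rw [c_le]
        refine h .hc α.1 β.1 hα ?_ β.2
        rw [← c_le, c_val, c_val]
        exact_mod_cast hαβ }
  have succ_val : ∀ x : Γ, ∃ b : Γ, succM x.1 = b.1 ∧ x - b ≠ 0 ∧ ψ (x - b) = b := by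
    intro x
    rcases cases_M (succM x.1) with h1 | ⟨b, hb⟩
    · exact absurd h1 (h .succFin _ x.2)
    · have h2 : psiM (addM x.1 (negM (succM x.1))) = succM x.1 := h .integration x.1
      rw [hb] at h2
      have h3 : ψ (x - b) = b := by
        rw [sub_eq_add_neg, ← c_val b]
        exact congrArg c h2
      refine ⟨b, hb, fun e => ?_, h3⟩
      rw [(hA.psi_eq_top_iff _).2 e] at h3
      exact absurd h3.symm WithTop.coe_ne_top
  have sub_add : ∀ x b : Γ, ψ (x - b) = b → ((x - b : Γ) : WithTop Γ) + ψ (x - b) = x := by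
    intro x b e
    rw [e, ← WithTop.coe_add, sub_add_cancel]
  have c_succ : ∀ x, c (succM x) = succ ψ (c x) := by
    intro x
    rcases cases_M x with rfl | ⟨x, rfl⟩
    · rw [h .succTop, c_top]
      rfl
    · obtain ⟨b, h1, h2, h3⟩ := succ_val x
      rw [h1, c_val, c_val, succ_coe, hA.integral_eq h2 (sub_add x b h3), h3]
  have mem_Psi : ∀ x : M, c x ∈ Psi ψ ↔ ∃ y : Γ, y ≠ 0 ∧ x = psiM y.1 := by
    intro x
    constructor
    · rintro ⟨y, hy, e⟩
      exact ⟨y, hy, (c_inj e).symm⟩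
    · rintro ⟨y, hy, rfl⟩
      exact ⟨y, hy, rfl⟩
  have succ_mem : ∀ x : M, x ≠ topM M → c (succM x) ∈ Psi ψ := by
    intro x hx
    obtain ⟨b, h1, h2, h3⟩ := succ_val ⟨x, hx⟩
    refine ⟨_, h2, ?_⟩
    rw [h3, ← c_val]
    exact congrArg c h1.symm
  have inPsi_mem : ∀ x : M, inPsiM x → c x ∈ Psi ψ := by
    rintro x ⟨h1, h2 | h2⟩
    · rw [h2]
      exact succ_mem _ (h .zeroFin)
    · rw [h2]
      refine succ_mem _ fun e => h1 ?_
      rw [h2, e]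
      exact h .succTop
  have lt_succ : ∀ x : M, c x ∈ Psi ψ → ltM x (succM x) := by
    intro x hx
    obtain ⟨y, hy, rfl⟩ := (mem_Psi x).1 hx
    exact h .ltSucc _ (nz y hy)
  have imm : ∀ x y : M, c x ∈ Psi ψ → c y ∈ Psi ψ → ltM x y → c (succM x) ≤ c y := by
    intro x y hx hy hxy
    obtain ⟨x, hx', rfl⟩ := (mem_Psi x).1 hx
    obtain ⟨y, hy', rfl⟩ := (mem_Psi y).1 hy
    rw [c_le]
    exact h .immediate _ _ (nz x hx') (nz y hy') hxy
  have ne_top : ∀ x : M, c x ∈ Psi ψ → x ≠ topM M := by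
    intro x hx
    obtain ⟨x, hx', rfl⟩ := (mem_Psi x).1 hx
    exact h .psiFin _ (nz x hx')
  have least : ∀ x : M, c x ∈ Psi ψ → c (succM (zeroM M)) ≤ c x := by
    intro x hx
    obtain ⟨x, hx', rfl⟩ := (mem_Psi x).1 hx
    rw [c_le]
    exact h .least _ (nz x hx')
  have c_succ0 : succ ψ ((0 : Γ) : WithTop Γ) = c (succM (zeroM M)) := by rw [c_succ, c_zero]
  have inj : ∀ x y : M, c x ∈ Psi ψ → c y ∈ Psi ψ → succM x = succM y → x = y := by
    intro x y hx hy e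
    rcases ltTotal x y with (h1 | h1) | h1
    · have h2 := imm x y hx hy h1
      rw [e] at h2
      exact absurd ((c_lt _ _).2 (lt_succ y hy)) (not_lt.2 h2)
    · exact h1
    · have h2 := imm y x hy hx h1
      rw [← e] at h2
      exact absurd ((c_lt _ _).2 (lt_succ x hx)) (not_lt.2 h2)
  have pred_on : ∀ x : M, predM x ≠ topM M → x = succM (predM x) ∧ c (predM x) ∈ Psi ψ ∧
      ltM (succM (zeroM M)) x := by
    intro x hx
    obtain ⟨⟨h1, h2⟩, h3⟩ := h .predOn x hx
    exact ⟨h1, inPsi_mem _ h2, h3⟩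
  have pred_spec : ∀ x : M, c x ∈ Psi ψ → ltM (succM (zeroM M)) x →
      c (predM x) ∈ Psi ψ ∧ succM (predM x) = x := by
    intro x hx hlt
    obtain ⟨y, hy, rfl⟩ := (mem_Psi x).1 hx
    obtain ⟨h1, h2 | h2⟩ := h .psiInPsi _ (nz y hy)
    · rw [← h2] at hlt
      exact absurd hlt (ltIrrefl _)
    · have h3 : predM (psiM y.1) ≠ topM M := by
        intro e
        rw [e] at h2
        exact h1 (h2.trans (h .succTop))
      exact ⟨(pred_on _ h3).2.1, h2.symm⟩
  have hL : IsLogCouple ψ :=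
    { hH with
      divisible := fun n hn α => by
        obtain ⟨y, -, hy⟩ := delta_spec ⟨n, hn⟩ α
        exact ⟨y, hy⟩
      integration := fun α => by
        obtain ⟨b, -, h2, h3⟩ := succ_val α
        exact ⟨α - b, h2, sub_add α b h3⟩
      least := by
        rw [c_succ0]
        refine ⟨succ_mem _ (h .zeroFin), fun x hx => ?_⟩
        rw [← cd x] at hx ⊢
        exact least _ hx
      least_pos := by
        rw [c_succ0, ← c_zero, c_lt]
        exact h .leastPos
      immediate := fun x hx => by
        rw [← cd x] at hx ⊢
        rw [← c_succ, c_lt]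
        refine ⟨succ_mem _ (ne_top _ hx), lt_succ _ hx, fun z hz hlt => ?_⟩
        rw [← cd z] at hz hlt ⊢
        exact imm _ _ hx hz ((c_lt _ _).1 hlt)
      bijection := by
        refine ⟨fun x hx => ?_, fun x hx y hy e => ?_, fun x hx => ?_⟩
        · rw [← cd x] at hx ⊢
          rw [← c_succ, c_succ0]
          exact ⟨succ_mem _ (ne_top _ hx),
            (least _ hx).trans_lt ((c_lt _ _).2 (lt_succ _ hx))⟩
        · rw [← cd x, ← cd y] at e
          rw [← cd x] at hx
          rw [← cd y] at hy
          rw [← c_succ, ← c_succ, c_inj.eq_iff] at e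
          rw [← cd x, ← cd y, inj _ _ hx hy e]
        · obtain ⟨hx1, hx2⟩ := hx
          rw [c_succ0, ← cd x, c_lt] at hx2
          rw [← cd x] at hx1
          obtain ⟨h1, h2⟩ := pred_spec _ hx1 hx2
          exact ⟨_, h1, by rw [← c_succ, h2, cd]⟩ }
  have c_pred : ∀ x, c (predM x) = pred ψ (c x) := by
    intro x
    by_cases hx : c x ∈ Psi ψ ∧ succ ψ ((0 : Γ) : WithTop Γ) < c x
    · obtain ⟨h1, h2⟩ := hL.pred_spec hx.1 hx.2
      obtain ⟨h3, h4⟩ := pred_spec x hx.1 (by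
        have := hx.2
        rwa [c_succ0, c_lt] at this)
      exact hL.bijection.injOn h3 h1 (by rw [h2, ← c_succ, h4])
    · rw [pred, if_neg hx, c_eq_top]
      by_contra hne
      obtain ⟨h1, h2, h3⟩ := pred_on x hne
      refine hx ⟨?_, ?_⟩
      · rw [h1]
        exact succ_mem _ (ne_top _ h2)
      · rw [c_succ0, c_lt]
        exact h3
  have e1 : ∀ x : Fin 1 → M, x = ![x 0] := fun x => by
    ext i
    fin_cases i
    rfl
  have e2 : ∀ x : Fin 2 → M, x = ![x 0, x 1] := fun x => by
    ext i
    fin_cases i <;> rfl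
  let := coupleStructure ψ
  refine ⟨Γ, cgrp, ord, oam, ψ, hL, ⟨⟨⟨c, d, dc, cd⟩, ?_, ?_⟩⟩⟩
  · intro n f x
    cases f with
    | zero => exact (congrArg c (congrArg _ (Subsingleton.elim _ _))).trans c_zero
    | infty => exact (congrArg c (congrArg _ (Subsingleton.elim _ _))).trans c_top
    | neg => exact (congrArg c (congrArg _ (e1 x))).trans (c_neg (x 0))
    | psi => exact (congrArg c (congrArg _ (e1 x))).trans (c_psi (x 0))
    | succ => exact (congrArg c (congrArg _ (e1 x))).trans (c_succ (x 0))
    | pred => exact (congrArg c (congrArg _ (e1 x))).trans (c_pred (x 0))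
    | delta k =>
      exact (congrArg c (congrArg _ (e1 x))).trans (c_delta k (x 0))
    | add => exact (congrArg c (congrArg _ (e2 x))).trans (c_add (x 0) (x 1))
  · intro n r x
    cases r with
    | lt =>
      exact (c_lt (x 0) (x 1)).trans (by rw [ltM, ← e2 x])

/-- The models of `T_log` are exactly the isomorphic copies of the `L`-structures of the couples
satisfying `IsLogCouple`. -/
theorem models_Tlog_iff (M : Type u) [Llog.Structure M] :
    M ⊨ Tlog ↔ ∃ (Γ : Type u) (_ : AddCommGroup Γ) (_ : LinearOrder Γ) (_ : IsOrderedAddMonoid Γ)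
      (ψ : Γ → WithTop Γ), IsLogCouple ψ ∧
        Nonempty (@FirstOrder.Language.Equiv Llog M (WithTop Γ) _ (coupleStructure ψ)) := by
  constructor
  · exact fun h => exists_couple (model_Tlog_iff_toProp.1 h)
  · rintro ⟨Γ, _, _, _, ψ, h, ⟨e⟩⟩
    let := coupleStructure ψ
    have : WithTop Γ ⊨ Tlog := h.model
    exact StrongHomClass.theory_model e.symm

end Converse

/-! ### Saturation -/

section Saturation

open FirstOrder.Language

/-- The structure `M` is `κ`-saturated: for every `A ⊆ M` with `|A| < κ`, every set of formulas in
one variable with parameters from `A` that is finitely satisfiable in `M` is realized in `M`. -/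
def IsSaturated (L : FirstOrder.Language.{0, 0}) (M : Type u) [L.Structure M]
    (κ : Cardinal.{v}) : Prop :=
  ∀ A : Set M, Cardinal.lift.{v} #A < Cardinal.lift.{u} κ →
    ∀ p : Set (L[[A]].Formula (Fin 1)),
      (∀ q : Finset (L[[A]].Formula (Fin 1)), ↑q ⊆ p →
        ∃ x : M, ∀ φ ∈ q, φ.Realize fun _ => x) →
      ∃ x : M, ∀ φ ∈ p, φ.Realize fun _ => x

end Saturation

end LogCouple

end

/-! Pass to couples and regard the small model as a `ℚ`-subspace `D` of the large one, closed under
`ψ`, `s` and `p`. The axioms of `Tlog` are universal (`isUniversal_Tlog`), so the intermediate model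
only has to be a substructure: it is enough to extend the embedding to one larger closed subspace.

Everything rests on the successor identity `psi_sub_of_finSucc_lt`: if `s x < s y`, then `ψ (x - y)
= s x`. There are two cases (`exists_parallel`).

Suppose some `b ∈ Ψ` lies outside `D`. Its iterated successors and predecessors form a chain `B`
indexed by `ℤ`, outside `D`, and all of its members realize the same cut in `D`
(`IsSuccChain.lt_iff`). The elements of `Ψ ∩ D` below `b` are cofinal in the lower part of this cut,
so saturation gives an element of `Ψ` on the other side in the corresponding cut (`exists_cut`),
with its own chain `B'`. The identity gives `ψ (B k - B l) = B (k + 1)` for `k < l`, and `ψ (B k -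
x) = min (s x) (B (k + 1))` for `x ∈ D`. A linear combination can therefore be split into terms with
distinct values, and its sign, value and successor are read off in the same way on both sides
(`ChainPair.isParallel`).

Suppose `Ψ ⊆ D`, and take any `α ∉ D`. All `ψ (α - x)` with `x ∈ D` lie in `D`, and any finitely
many of the conditions describing `α` over `D` are already met by an element of `D`
(`exists_approx`). Saturation gives a matching `α'` (`exists_type`), and `D + ℚ α` is closed because
`D` already contains all of `Ψ` (`isParallel_of_finPsi_subset`).

In both cases the two extensions are images of one vector space `W` under two linear maps.
`IsParallel` lists what has to match; agreement of `s` and `p` then follows, because `s x` is the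
only `b` with `ψ (x - b) = b`. -/

noncomputable section

namespace LogCouple

universe u v w

/-! ### Divisible ordered groups as rational vector spaces -/

section Rational

variable {Γ : Type u} [AddCommGroup Γ] [LinearOrder Γ] [IsOrderedAddMonoid Γ]

/-- The vector space structure over `ℚ` of a divisible ordered abelian group. -/
@[reducible] def ratModule (hd : ∀ n : ℕ, 1 ≤ n → ∀ α : Γ, ∃ β : Γ, n • β = α) : Module ℚ Γ := by
  have key : ∀ (q : ℚ) (x : Γ), ∃ y : Γ, (q.den : ℤ) • y = q.num • x := fun q x => by
    obtain ⟨y, hy⟩ := hd q.den q.den_pos (q.num • x)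
    exact ⟨y, by rw [natCast_zsmul, hy]⟩
  choose f hf using key
  -- An ordered group is torsion-free, so every module axiom may be checked after clearing
  -- denominators.
  have cancel : ∀ (q : ℚ) {x y : Γ}, (q.den : ℤ) • x = (q.den : ℤ) • y → x = y := fun q x y h =>
    zsmul_right_injective (by exact_mod_cast q.den_nz) h
  exact
    { smul := f
      one_smul := fun x => cancel 1 <| (hf 1 x).trans (by simp)
      mul_smul := fun p q x => by
        change f (p * q) x = f p (f q x)
        apply cancel (p * q)
        apply cancel p
        apply cancel q
        have e : (q.den : ℤ) • (p.den : ℤ) • ((p * q).den : ℤ) • f p (f q x) =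
            ((p * q).den : ℤ) • p.num • q.num • x := by
          rw [smul_comm (p.den : ℤ), hf, smul_comm (q.den : ℤ), smul_comm (q.den : ℤ), hf]
        rw [hf, e]
        simp only [smul_smul]
        congr 1
        have := Rat.mul_num_den' p q
        linarith
      smul_zero := fun q => cancel q <| (hf q 0).trans (by simp)
      smul_add := fun q x y => cancel q <| (hf q _).trans <| by
        rw [smul_add, smul_add]
        exact congrArg₂ _ (hf q x).symm (hf q y).symm
      add_smul := fun p q x => by
        change f (p + q) x = f p x + f q x
        apply cancel (p + q)
        apply cancel p
        apply cancel q
        have e : (q.den : ℤ) • (p.den : ℤ) • ((p + q).den : ℤ) • (f p x + f q x) =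
            ((p + q).den : ℤ) • ((q.den : ℤ) • p.num • x + (p.den : ℤ) • q.num • x) := by
          rw [smul_comm (p.den : ℤ), smul_comm (q.den : ℤ), smul_add, smul_add, hf,
            smul_comm (q.den : ℤ) (p.den : ℤ), hf]
        rw [hf, e]
        simp only [smul_smul, ← add_smul]
        congr 1
        have := Rat.add_num_den' p q
        linarith
      zero_smul := fun x => cancel 0 <| (hf 0 x).trans (by simp) }

theorem den_smul_smul [Module ℚ Γ] (q : ℚ) (x : Γ) : (q.den : ℤ) • (q • x) = q.num • x := by
  rw [← Int.cast_smul_eq_zsmul ℚ, ← Int.cast_smul_eq_zsmul ℚ, smul_smul]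
  congr 1
  exact_mod_cast Rat.den_mul_eq_num q

/-- No compatibility of scalars with the order is assumed: clearing the denominator reduces it to
integer multiples. -/
theorem pos_smul_iff [Module ℚ Γ] {q : ℚ} (hq : 0 < q) (x : Γ) : 0 < q • x ↔ 0 < x := by
  have h1 : 0 < (q.den : ℤ) • (q • x) ↔ 0 < q • x := smul_pos_iff_of_pos_left (by exact_mod_cast q.den_pos)
  rw [← h1, den_smul_smul, smul_pos_iff_of_pos_left (Rat.num_pos.2 hq)]

end Rational

/-! ### The valuation of an `H`-asymptotic couple -/

section Valuation

variable {Γ : Type u} [AddCommGroup Γ] [LinearOrder Γ] [IsOrderedAddMonoid Γ]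
  {ψ : Γ → WithTop Γ}


theorem IsAsymptoticCouple.psi_zero (h : IsAsymptoticCouple ψ) : ψ 0 = ⊤ :=
  (h.psi_eq_top_iff 0).2 rfl

theorem IsAsymptoticCouple.ne_zero (h : IsAsymptoticCouple ψ) {x : Γ} (hx : ψ x ≠ ⊤) : x ≠ 0 :=
  fun e => hx (e ▸ h.psi_zero)

theorem IsAsymptoticCouple.psi_neg (h : IsAsymptoticCouple ψ) (x : Γ) : ψ (-x) = ψ x := by
  rcases eq_or_ne x 0 with rfl | hx
  · rw [neg_zero]
  · rw [← neg_one_zsmul]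
    exact h.ac2 x hx (-1) (by decide)

theorem IsAsymptoticCouple.psi_sub_comm (h : IsAsymptoticCouple ψ) (x y : Γ) :
    ψ (x - y) = ψ (y - x) := by
  rw [← h.psi_neg, neg_sub]

theorem IsAsymptoticCouple.min_le_psi_add (h : IsAsymptoticCouple ψ) (x y : Γ) :
    min (ψ x) (ψ y) ≤ ψ (x + y) := by
  rcases eq_or_ne x 0 with rfl | hx
  · simp
  rcases eq_or_ne y 0 with rfl | hy
  · simp
  rcases eq_or_ne (x + y) 0 with e | hxy
  · rw [e, h.psi_zero]
    exact le_top
  · exact h.ac1 x y hx hy hxy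

theorem IsAsymptoticCouple.le_psi_add (h : IsAsymptoticCouple ψ) {x y : Γ} {c : WithTop Γ}
    (hx : c ≤ ψ x) (hy : c ≤ ψ y) : c ≤ ψ (x + y) :=
  (le_min hx hy).trans (h.min_le_psi_add x y)

theorem IsAsymptoticCouple.le_psi_sub (h : IsAsymptoticCouple ψ) {x y : Γ} {c : WithTop Γ}
    (hx : c ≤ ψ x) (hy : c ≤ ψ y) : c ≤ ψ (x - y) := by
  rw [sub_eq_add_neg]
  exact h.le_psi_add hx (by rwa [h.psi_neg])

/-- The ultrametric equality: a larger value of `x + y` would force a larger value of `x = (x + y) -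
y`. -/
theorem IsAsymptoticCouple.psi_add_of_lt (h : IsAsymptoticCouple ψ) {x y : Γ}
    (hxy : ψ x < ψ y) : ψ (x + y) = ψ x := by
  refine le_antisymm (not_lt.1 fun hlt => ?_) (h.le_psi_add le_rfl hxy.le)
  have h1 : min (ψ (x + y)) (ψ y) ≤ ψ x := by
    have := h.min_le_psi_add (x + y) (-y)
    rwa [h.psi_neg, add_neg_cancel_right] at this
  exact absurd (lt_min hlt hxy) (not_lt.2 h1)

theorem IsAsymptoticCouple.psi_smul [Module ℚ Γ] (h : IsAsymptoticCouple ψ) {q : ℚ} (hq : q ≠ 0)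
    (x : Γ) : ψ (q • x) = ψ x := by
  rcases eq_or_ne x 0 with rfl | hx
  · rw [smul_zero]
  · rw [← h.ac2 (q • x) (smul_ne_zero hq hx) q.den (by exact_mod_cast q.den_nz), den_smul_smul,
      h.ac2 x hx _ (Rat.num_ne_zero.2 hq)]

theorem IsHAsymptoticCouple.psi_anti (h : IsHAsymptoticCouple ψ) {x y : Γ} (hx : 0 ≤ x)
    (hxy : x ≤ y) : ψ y ≤ ψ x := by
  rcases hx.eq_or_lt with rfl | hx
  · rw [h.psi_zero]
    exact le_top
  · exact h.hc x y hx hxy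

/-- The sign of a sum is determined by the summand of smaller value. -/
theorem IsHAsymptoticCouple.add_pos_iff (h : IsHAsymptoticCouple ψ) {x y : Γ}
    (hxy : ψ x < ψ y) : 0 < x + y ↔ 0 < x := by
  have hx : x ≠ 0 := h.ne_zero hxy.ne_top
  constructor
  · intro hp
    by_contra hn
    have hx' : x < 0 := lt_of_le_of_ne (not_lt.1 hn) hx
    -- Here `0 < -x < y`, so `H`-type gives `ψ y ≤ ψ x`.
    have h1 := h.psi_anti (neg_pos.2 hx').le (neg_lt_iff_pos_add'.2 hp).le
    rw [h.psi_neg] at h1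
    exact absurd hxy (not_lt.2 h1)
  · intro hp
    by_contra hn
    have h1 := h.psi_anti hp.le (le_neg_iff_add_nonpos_right.2 (not_lt.1 hn))
    rw [h.psi_neg] at h1
    exact absurd hxy (not_lt.2 h1)

end Valuation

/-! ### The set `Ψ` and the successor function inside the group -/

section Successor

variable {Γ : Type u} [AddCommGroup Γ] [LinearOrder Γ] [IsOrderedAddMonoid Γ]
  {ψ : Γ → WithTop Γ}

/-- The set `Ψ`, as a subset of `Γ`. -/
def finPsi (ψ : Γ → WithTop Γ) : Set Γ := {b | ∃ x, ψ x = b}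

/-- The successor function as a function `Γ → Γ`. -/
def finSucc (ψ : Γ → WithTop Γ) (x : Γ) : Γ := (succ ψ x).untopD 0

namespace IsLogCouple

theorem coe_mem_Psi (h : IsLogCouple ψ) {b : Γ} : (b : WithTop Γ) ∈ Psi ψ ↔ b ∈ finPsi ψ := by
  constructor
  · rintro ⟨x, -, hx⟩
    exact ⟨x, hx⟩
  · rintro ⟨x, hx⟩
    exact ⟨x, h.ne_zero (hx ▸ WithTop.coe_ne_top), hx⟩

/-- The default value `0` in `finSucc` is never taken, since `s` is finite on `Γ`. -/
theorem coe_finSucc (h : IsLogCouple ψ) (x : Γ) : succ ψ x = finSucc ψ x := by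
  obtain ⟨b, hb, -⟩ := h.succ_spec x
  rw [finSucc, hb, WithTop.untopD_coe]

theorem psi_sub_finSucc (h : IsLogCouple ψ) (x : Γ) : ψ (x - finSucc ψ x) = finSucc ψ x := by
  obtain ⟨b, hb, -, hb'⟩ := h.succ_spec x
  rwa [finSucc, hb, WithTop.untopD_coe]

/-- Such an `x - b` is an integral of `x`, and integrals are unique. Thus `s` is determined by `ψ`,
which is why maps preserving `ψ` preserve `s`. -/
theorem finSucc_eq (h : IsLogCouple ψ) {x b : Γ} (e : ψ (x - b) = b) : finSucc ψ x = b := by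
  have h0 : x - b ≠ 0 := h.ne_zero (e ▸ WithTop.coe_ne_top)
  have h1 := h.integral_eq (α := x) h0 (by rw [e, ← WithTop.coe_add, sub_add_cancel])
  rw [finSucc, succ_coe, h1, e, WithTop.untopD_coe]

theorem finSucc_mem (h : IsLogCouple ψ) (x : Γ) : finSucc ψ x ∈ finPsi ψ :=
  ⟨_, h.psi_sub_finSucc x⟩

theorem finSucc_zero_le (h : IsLogCouple ψ) {b : Γ} (hb : b ∈ finPsi ψ) : finSucc ψ 0 ≤ b := by
  have := h.least.2 (h.coe_mem_Psi.2 hb)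
  rw [h.coe_finSucc] at this
  exact_mod_cast this

theorem lt_finSucc (h : IsLogCouple ψ) {b : Γ} (hb : b ∈ finPsi ψ) : b < finSucc ψ b := by
  have := (h.immediate _ (h.coe_mem_Psi.2 hb)).2.1
  rw [h.coe_finSucc] at this
  exact_mod_cast this

theorem finSucc_le (h : IsLogCouple ψ) {a b : Γ} (ha : a ∈ finPsi ψ) (hb : b ∈ finPsi ψ)
    (hab : a < b) : finSucc ψ a ≤ b := by
  have := (h.immediate _ (h.coe_mem_Psi.2 ha)).2.2 b (h.coe_mem_Psi.2 hb) (by exact_mod_cast hab)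
  rw [h.coe_finSucc] at this
  exact_mod_cast this

theorem finSucc_lt_finSucc (h : IsLogCouple ψ) {a b : Γ} (ha : a ∈ finPsi ψ) (hb : b ∈ finPsi ψ)
    (hab : a < b) : finSucc ψ a < finSucc ψ b :=
  (h.finSucc_le ha hb hab).trans_lt (h.lt_finSucc hb)

theorem finSucc_injOn (h : IsLogCouple ψ) : Set.InjOn (finSucc ψ) (finPsi ψ) := by
  intro a ha b hb e
  rcases lt_trichotomy a b with hab | hab | hab
  · exact absurd e (h.finSucc_lt_finSucc ha hb hab).ne
  · exact hab
  · exact absurd e (h.finSucc_lt_finSucc hb ha hab).ne'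

theorem finSucc_zero_lt (h : IsLogCouple ψ) {b : Γ} (hb : b ∈ finPsi ψ) :
    finSucc ψ 0 < finSucc ψ b :=
  (h.finSucc_zero_le hb).trans_lt (h.lt_finSucc hb)

theorem pred_eq_coe (h : IsLogCouple ψ) {b c : Γ} (hb : b ∈ finPsi ψ) (e : finSucc ψ b = c) :
    pred ψ c = b := by
  have h1 : (c : WithTop Γ) ∈ Psi ψ := h.coe_mem_Psi.2 (e ▸ h.finSucc_mem b)
  have h2 : succ ψ (0 : Γ) < c := by
    rw [h.coe_finSucc, ← e]
    exact_mod_cast h.finSucc_zero_lt hb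
  obtain ⟨h3, h4⟩ := h.pred_spec h1 h2
  refine h.bijection.injOn h3 (h.coe_mem_Psi.2 hb) ?_
  rw [h4, h.coe_finSucc, e]

theorem exists_finSucc_eq (h : IsLogCouple ψ) {b : Γ} (hb : b ∈ finPsi ψ)
    (hlt : finSucc ψ 0 < b) : ∃ a ∈ finPsi ψ, finSucc ψ a = b := by
  obtain ⟨h1, h2⟩ := h.pred_spec (h.coe_mem_Psi.2 hb) (by
    rw [h.coe_finSucc]
    exact_mod_cast hlt)
  obtain ⟨x, hx, e⟩ := h1
  obtain ⟨a, ha⟩ := h.exists_coe hx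
  refine ⟨a, ⟨x, ha⟩, ?_⟩
  rw [← e, ha, h.coe_finSucc] at h2
  exact_mod_cast h2

theorem pred_eq_top (h : IsLogCouple ψ) {c : Γ} (hc : ∀ b ∈ finPsi ψ, finSucc ψ b ≠ c) :
    pred ψ c = ⊤ := by
  rw [pred, if_neg]
  rintro ⟨h1, h2⟩
  rw [h.coe_finSucc] at h2
  obtain ⟨a, ha, e⟩ := h.exists_finSucc_eq (h.coe_mem_Psi.1 h1) (by exact_mod_cast h2)
  exact hc a ha e

theorem pred_top (h : IsLogCouple ψ) : pred ψ ⊤ = ⊤ := by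
  rw [pred, if_neg]
  rintro ⟨⟨x, hx, e⟩, -⟩
  exact hx ((h.psi_eq_top_iff x).1 e)

/-- If `ψ (b - a) ≤ a`, then `(b - a) + ψ (b - a) ≤ b`, although `γ + ψ γ` exceeds all of `Ψ` for `γ
> 0`. -/
theorem lt_psi_sub (h : IsLogCouple ψ) {a b : Γ} (hb : b ∈ finPsi ψ) (hab : a < b) :
    (a : WithTop Γ) < ψ (b - a) := by
  by_contra hn
  obtain ⟨x, hx⟩ := hb
  have hx0 : x ≠ 0 := h.ne_zero (hx ▸ WithTop.coe_ne_top)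
  have h1 := h.ac3 (b - a) x (sub_pos.2 hab).ne' hx0 (sub_pos.2 hab)
  rw [hx] at h1
  have h2 : ((b - a : Γ) : WithTop Γ) + ψ (b - a) ≤ ((b - a : Γ) : WithTop Γ) + a := by
    gcongr
    exact not_lt.1 hn
  rw [← WithTop.coe_add, sub_add_cancel] at h2
  exact absurd h1 (not_lt.2 h2)

/-- The successor identity. -/
theorem psi_sub_of_finSucc_lt (h : IsLogCouple ψ) {x y : Γ} (hxy : finSucc ψ x < finSucc ψ y) :
    ψ (x - y) = finSucc ψ x := by
  have h1 := h.lt_psi_sub (h.finSucc_mem y) hxy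
  have h2 : ((finSucc ψ x : Γ) : WithTop Γ) < ψ (y - finSucc ψ y) := by
    rw [h.psi_sub_finSucc]
    exact_mod_cast hxy
  -- Write `x - y = (x - s x) - (s y - s x) - (y - s y)`: the first term has value `s x`, the other
  -- two have larger values.
  have h3 : ψ (x - finSucc ψ x) < ψ (-(finSucc ψ y - finSucc ψ x) + -(y - finSucc ψ y)) := by
    rw [h.psi_sub_finSucc]
    refine (lt_min ?_ ?_).trans_le (h.min_le_psi_add _ _) <;> rwa [h.psi_neg]
  have h4 := h.psi_add_of_lt h3
  rw [h.psi_sub_finSucc] at h4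
  rw [← h4]
  congr 1
  abel

theorem psi_sub_eq_min (h : IsLogCouple ψ) {x y : Γ} (hxy : finSucc ψ x ≠ finSucc ψ y) :
    ψ (x - y) = ((min (finSucc ψ x) (finSucc ψ y) : Γ) : WithTop Γ) := by
  rcases lt_or_gt_of_ne hxy with h1 | h1
  · rw [min_eq_left h1.le, h.psi_sub_of_finSucc_lt h1]
  · rw [min_eq_right h1.le, h.psi_sub_comm, h.psi_sub_of_finSucc_lt h1]

/-- A converse of the successor identity. If `s x = s y`, then `x - s x` and `y - s x` both have
value `s y`, so `ψ (x - y) ≥ s y > b`. Otherwise `b` is the minimum of two different successors, and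
it is not `s y`. It serves to compute `s x` by comparing `x` with an element whose successor is
large. -/
theorem finSucc_eq_of_psi_sub_lt (h : IsLogCouple ψ) {x y b : Γ} (e : ψ (x - y) = b)
    (hb : b < finSucc ψ y) : finSucc ψ x = b := by
  rcases eq_or_ne (finSucc ψ x) (finSucc ψ y) with e1 | hne
  · exfalso
    have h1 := h.le_psi_sub (h.psi_sub_finSucc x).ge
      (show ((finSucc ψ x : Γ) : WithTop Γ) ≤ ψ (y - finSucc ψ y) by rw [h.psi_sub_finSucc, e1])
    rw [e1, sub_sub_sub_cancel_right, e] at h1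
    exact absurd hb (not_lt.2 (by exact_mod_cast h1))
  · rw [h.psi_sub_eq_min hne] at e
    have e' : min (finSucc ψ x) (finSucc ψ y) = b := by exact_mod_cast e
    rcases min_choice (finSucc ψ x) (finSucc ψ y) with h1 | h1
    · rw [← e', h1]
    · rw [h1] at e'
      exact absurd e' hb.ne'

/-- Otherwise the integral `x - s x` of `x` is positive, and then `x` lies above all of `Ψ`. -/
theorem lt_finSucc_of_lt (h : IsLogCouple ψ) {x b : Γ} (hb : b ∈ finPsi ψ) (hx : x < b) :
    x < finSucc ψ x := by
  have e := h.psi_sub_finSucc x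
  have h0 : x - finSucc ψ x ≠ 0 := h.ne_zero (e ▸ WithTop.coe_ne_top)
  by_contra hn
  have hpos : 0 < x - finSucc ψ x := lt_of_le_of_ne (sub_nonneg.2 (not_lt.1 hn)) h0.symm
  obtain ⟨y, hy⟩ := hb
  have h1 := h.ac3 _ y h0 (h.ne_zero (hy ▸ WithTop.coe_ne_top)) hpos
  rw [e, hy, ← WithTop.coe_add, sub_add_cancel] at h1
  exact absurd hx (not_lt.2 (by exact_mod_cast h1.le))

/-- If not, then `s b < s x`, so `ψ (x - b) = s b`. But `0 < b - x < s x - x` and `H`-type give `ψ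
(b - x) ≥ s x`. -/
theorem finSucc_lt_of_lt (h : IsLogCouple ψ) {x b : Γ} (hb : b ∈ finPsi ψ) (hx : x < b)
    (h1 : finSucc ψ x ≠ b) (h2 : finSucc ψ x ≠ finSucc ψ b) : finSucc ψ x < b := by
  by_contra hn
  have hlt : b < finSucc ψ x := lt_of_le_of_ne (not_lt.1 hn) h1.symm
  have h3 : finSucc ψ b < finSucc ψ x :=
    lt_of_le_of_ne (h.finSucc_le hb (h.finSucc_mem x) hlt) h2.symm
  have h4 := h.psi_sub_of_finSucc_lt h3
  have h5 := h.psi_anti (sub_nonneg.2 hx.le) (sub_le_sub_right hlt.le x)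
  rw [h4, h.psi_sub_comm, h.psi_sub_finSucc] at h5
  exact absurd h3 (not_lt.2 (by exact_mod_cast h5))

end IsLogCouple

end Successor

/-! ### Pairs of linear maps into two couples -/

section Agreement

variable {Γ : Type u} [AddCommGroup Γ] [LinearOrder Γ] [IsOrderedAddMonoid Γ] [Module ℚ Γ]
  {Γ' : Type v} [AddCommGroup Γ'] [LinearOrder Γ'] [IsOrderedAddMonoid Γ'] [Module ℚ Γ']
  {W : Type w} [AddCommGroup W] [Module ℚ W]
  {ψ' : Γ' → WithTop Γ'} {ψ : Γ → WithTop Γ} {Φ' : W →ₗ[ℚ] Γ'} {Φ : W →ₗ[ℚ] Γ}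

/-- The image of `smaller` is less than that of `largerElement` in both couples. -/
def BothLT (Φ : W →ₗ[ℚ] Γ) (Φ' : W →ₗ[ℚ] Γ') (smaller largerElement : W) : Prop :=
  Φ smaller < Φ largerElement ∧ Φ' smaller < Φ' largerElement

/-- The images of `w` in both couples have the same sign, and their values are the images of
`u`. -/
structure Agree (ψ : Γ → WithTop Γ) (ψ' : Γ' → WithTop Γ') (Φ : W →ₗ[ℚ] Γ) (Φ' : W →ₗ[ℚ] Γ')
    (w u : W) : Prop where
  left : ψ (Φ w) = Φ u
  right : ψ' (Φ' w) = Φ' u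
  pos_iff : 0 < Φ w ↔ 0 < Φ' w

namespace Agree

theorem ne_zero_left (h : IsLogCouple ψ) {w u : W} (hw : Agree ψ ψ' Φ Φ' w u) : Φ w ≠ 0 :=
  h.ne_zero (hw.left ▸ WithTop.coe_ne_top)

theorem ne_zero_right (h' : IsLogCouple ψ') {w u : W} (hw : Agree ψ ψ' Φ Φ' w u) : Φ' w ≠ 0 :=
  h'.ne_zero (hw.right ▸ WithTop.coe_ne_top)

theorem neg (h : IsLogCouple ψ) (h' : IsLogCouple ψ') {w u : W} (hw : Agree ψ ψ' Φ Φ' w u) :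
    Agree ψ ψ' Φ Φ' (-w) u where
  left := by rw [map_neg, h.psi_neg, hw.left]
  right := by rw [map_neg, h'.psi_neg, hw.right]
  pos_iff := by
    rw [map_neg, map_neg, neg_pos, neg_pos, ← not_le, ← not_le,
      (hw.ne_zero_left h).symm.le_iff_lt, (hw.ne_zero_right h').symm.le_iff_lt, hw.pos_iff]

theorem smul (h : IsLogCouple ψ) (h' : IsLogCouple ψ') {w u : W} (hw : Agree ψ ψ' Φ Φ' w u)
    {q : ℚ} (hq : q ≠ 0) : Agree ψ ψ' Φ Φ' (q • w) u := by
  wlog hpos : 0 < q generalizing q with H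
  · have h1 := (H (neg_ne_zero.2 hq) (neg_pos.2 (lt_of_le_of_ne (not_lt.1 hpos) hq))).neg h h'
    rwa [neg_smul, neg_neg] at h1
  · exact
      { left := by rw [map_smul, h.psi_smul hq, hw.left]
        right := by rw [map_smul, h'.psi_smul hq, hw.right]
        pos_iff := by
          rw [map_smul, map_smul, pos_smul_iff hpos, pos_smul_iff hpos, hw.pos_iff] }

theorem add_of_lt (h : IsLogCouple ψ) (h' : IsLogCouple ψ') {w u w' u' : W}
    (hw : Agree ψ ψ' Φ Φ' w u) (hw' : Agree ψ ψ' Φ Φ' w' u') (hu : BothLT Φ Φ' u u') :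
    Agree ψ ψ' Φ Φ' (w + w') u := by
  have h1 : ψ (Φ w) < ψ (Φ w') := by
    rw [hw.left, hw'.left]
    exact_mod_cast hu.1
  have h2 : ψ' (Φ' w) < ψ' (Φ' w') := by
    rw [hw.right, hw'.right]
    exact_mod_cast hu.2
  exact
    { left := by rw [map_add, h.psi_add_of_lt h1, hw.left]
      right := by rw [map_add, h'.psi_add_of_lt h2, hw.right]
      pos_iff := by rw [map_add, map_add, h.add_pos_iff h1, h'.add_pos_iff h2, hw.pos_iff] }

/-- The values of the summands are distinct and ordered alike on both sides, so the same summand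
dominates in both couples. -/
theorem sum (h : IsLogCouple ψ) (h' : IsLogCouple ψ') {ι : Type*} {s : Finset ι}
    (hs : s.Nonempty) {f u : ι → W} (hf : ∀ k ∈ s, Agree ψ ψ' Φ Φ' (f k) (u k))
    (hu : ∀ k ∈ s, ∀ l ∈ s, k ≠ l → BothLT Φ Φ' (u k) (u l) ∨ BothLT Φ Φ' (u l) (u k)) :
    ∃ k ∈ s, Agree ψ ψ' Φ Φ' (∑ k ∈ s, f k) (u k) := by
  classical
  induction hs using Finset.Nonempty.cons_induction with
  | singleton a => exact ⟨a, by simp, by simpa using hf a (by simp)⟩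
  | cons a s ha hs ih =>
    obtain ⟨k, hk, hk'⟩ := ih (fun k hk => hf k (Finset.mem_cons_of_mem hk))
      (fun k hk l hl => hu k (Finset.mem_cons_of_mem hk) l (Finset.mem_cons_of_mem hl))
    have hka : k ∈ Finset.cons a s ha := Finset.mem_cons_of_mem hk
    have haa : a ∈ Finset.cons a s ha := Finset.mem_cons_self a s
    rw [Finset.sum_cons]
    rcases hu a haa k hka (fun e => ha (e ▸ hk)) with hlt | hlt
    · exact ⟨a, haa, (hf a haa).add_of_lt h h' hk' hlt⟩
    · refine ⟨k, hka, ?_⟩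
      rw [add_comm]
      exact hk'.add_of_lt h h' (hf a haa) hlt

end Agree

/-- The images of the two maps are isomorphic couples, closed under successors and
predecessors. -/
structure IsParallel (ψ : Γ → WithTop Γ) (ψ' : Γ' → WithTop Γ') (Φ : W →ₗ[ℚ] Γ)
    (Φ' : W →ₗ[ℚ] Γ') : Prop where
  agree : ∀ w, w ≠ 0 → ∃ u, Agree ψ ψ' Φ Φ' w u
  succ : ∀ w, ∃ u, finSucc ψ (Φ w) = Φ u
  pred : ∀ w, Φ w ∈ finPsi ψ → finSucc ψ 0 < Φ w → ∃ u, Φ u ∈ finPsi ψ ∧ finSucc ψ (Φ u) = Φ w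

namespace IsParallel

theorem pos_iff (hp : IsParallel ψ ψ' Φ Φ') (w : W) : 0 < Φ w ↔ 0 < Φ' w := by
  rcases eq_or_ne w 0 with rfl | hw
  · simp
  · obtain ⟨u, hu⟩ := hp.agree w hw
    exact hu.pos_iff

theorem lt_iff (hp : IsParallel ψ ψ' Φ Φ') (w w' : W) : Φ w < Φ w' ↔ Φ' w < Φ' w' := by
  rw [← sub_pos, ← map_sub, hp.pos_iff, map_sub, sub_pos]

theorem injective (h : IsLogCouple ψ) (hp : IsParallel ψ ψ' Φ Φ') :
    Function.Injective Φ := by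
  rw [injective_iff_map_eq_zero]
  intro w hw
  by_contra hne
  obtain ⟨u, hu⟩ := hp.agree w hne
  exact hu.ne_zero_left h hw

theorem injective_right (h' : IsLogCouple ψ') (hp : IsParallel ψ ψ' Φ Φ') :
    Function.Injective Φ' := by
  rw [injective_iff_map_eq_zero]
  intro w hw
  by_contra hne
  obtain ⟨u, hu⟩ := hp.agree w hne
  exact hu.ne_zero_right h' hw

theorem map_psi (h : IsLogCouple ψ) (hp : IsParallel ψ ψ' Φ Φ') {w u : W} (e : ψ (Φ w) = Φ u) : ψ' (Φ' w) = Φ' u := by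
  have hw : w ≠ 0 := by
    rintro rfl
    rw [map_zero, h.psi_zero] at e
    exact absurd e.symm WithTop.coe_ne_top
  obtain ⟨z, hz⟩ := hp.agree w hw
  have e1 := hz.left
  rw [e] at e1
  rw [hz.right, hp.injective h (WithTop.coe_injective e1)]

/-- The equation `ψ (x - b) = b` characterizes `b = s x` and is carried from one side to the other.
-/
theorem map_succ (h : IsLogCouple ψ) (h' : IsLogCouple ψ') (hp : IsParallel ψ ψ' Φ Φ')
    {w u : W} (e : finSucc ψ (Φ w) = Φ u) : finSucc ψ' (Φ' w) = Φ' u := by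
  apply h'.finSucc_eq
  rw [← map_sub]
  apply hp.map_psi h
  rw [map_sub, ← e, h.psi_sub_finSucc]

theorem map_succ_zero (h : IsLogCouple ψ) (h' : IsLogCouple ψ') (hp : IsParallel ψ ψ' Φ Φ')
    {u : W} (e : finSucc ψ 0 = Φ u) : finSucc ψ' 0 = Φ' u := by
  rw [← map_zero Φ] at e
  rw [← map_zero Φ', hp.map_succ h h' e]

/-- An element of `Ψ` is `s 0` or a successor, and both descriptions carry over. -/
theorem map_mem (h : IsLogCouple ψ) (h' : IsLogCouple ψ') (hp : IsParallel ψ ψ' Φ Φ')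
    {u : W} (hu : Φ u ∈ finPsi ψ) : Φ' u ∈ finPsi ψ' := by
  rcases (h.finSucc_zero_le hu).eq_or_lt with e | hlt
  · rw [← hp.map_succ_zero h h' e]
    exact h'.finSucc_mem _
  · obtain ⟨z, -, hz⟩ := hp.pred u hu hlt
    rw [← hp.map_succ h h' hz]
    exact h'.finSucc_mem _

/-- The two maps are compatible with predecessors. -/
theorem pred_cases (h : IsLogCouple ψ) (h' : IsLogCouple ψ') (hp : IsParallel ψ ψ' Φ Φ')
    (w : W) : (∃ u, LogCouple.pred ψ (Φ w) = Φ u ∧ LogCouple.pred ψ' (Φ' w) = Φ' u) ∨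
    (LogCouple.pred ψ (Φ w) = ⊤ ∧ LogCouple.pred ψ' (Φ' w) = ⊤) := by
  by_cases hw : Φ w ∈ finPsi ψ ∧ finSucc ψ 0 < Φ w
  · obtain ⟨u, hu, e⟩ := hp.pred w hw.1 hw.2
    exact Or.inl ⟨u, h.pred_eq_coe hu e,
      h'.pred_eq_coe (hp.map_mem h h' hu) (hp.map_succ h h' e)⟩
  · right
    constructor
    · refine h.pred_eq_top fun b hb e => hw ?_
      rw [← e]
      exact ⟨h.finSucc_mem b, h.finSucc_zero_lt hb⟩
    · refine h'.pred_eq_top fun b hb e => hw ?_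
      -- The predecessor `b` is not known to lie in the image of `Φ'`. So go up to the successor `Φ
      -- u` of `Φ w` and take the predecessor `Φ z` of `Φ u` in `Ψ`; injectivity of `s` on `Ψ` in
      -- the second couple forces `z = w`, whence `Φ w ∈ Ψ`.
      obtain ⟨u, hu⟩ := hp.succ w
      have hu' := hp.map_succ h h' hu
      have hmem : Φ' w ∈ finPsi ψ' := e ▸ h'.finSucc_mem b
      have hlt : finSucc ψ' 0 < Φ' w := e ▸ h'.finSucc_zero_lt hb
      have hne : finSucc ψ 0 ≠ Φ u := fun e0 => by
        have h1 := h'.finSucc_zero_lt hmem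
        rw [hp.map_succ_zero h h' e0, hu'] at h1
        exact lt_irrefl _ h1
      have huΨ : Φ u ∈ finPsi ψ := hu ▸ h.finSucc_mem _
      obtain ⟨z, hz, hz'⟩ := hp.pred u huΨ (lt_of_le_of_ne (h.finSucc_zero_le huΨ) hne)
      have e2 : z = w := hp.injective_right h'
        (h'.finSucc_injOn (hp.map_mem h h' hz) hmem ((hp.map_succ h h' hz').trans hu'.symm))
      subst e2
      refine ⟨hz, lt_of_le_of_ne (h.finSucc_zero_le hz) fun e0 => ?_⟩
      rw [hp.map_succ_zero h h' e0] at hlt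
      exact lt_irrefl _ hlt

end IsParallel

end Agreement

/-! ### Subspaces and partial embeddings -/

section Subspaces

variable {Γ : Type u} [AddCommGroup Γ] [LinearOrder Γ] [IsOrderedAddMonoid Γ] [Module ℚ Γ]
  {Γ' : Type v} [AddCommGroup Γ'] [LinearOrder Γ'] [IsOrderedAddMonoid Γ'] [Module ℚ Γ']
  {ψ' : Γ' → WithTop Γ'} {ψ : Γ → WithTop Γ}

/-- A subspace closed under `ψ`, `s` and `p`. -/
structure IsLogSubspace (ψ : Γ → WithTop Γ) (D : Submodule ℚ Γ) : Prop where
  psi_mem : ∀ x ∈ D, ∀ c : Γ, ψ x = c → c ∈ D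
  succ_mem : ∀ x ∈ D, finSucc ψ x ∈ D
  pred_mem : ∀ x ∈ finPsi ψ, finSucc ψ x ∈ D → x ∈ D

/-- An embedding of a subspace into another couple. -/
structure IsLogEmbedding (ψ : Γ → WithTop Γ) (ψ' : Γ' → WithTop Γ') (D : Submodule ℚ Γ)
    (i : D →ₗ[ℚ] Γ') : Prop where
  isLogSubspace : IsLogSubspace ψ D
  isLogSubspace_range : IsLogSubspace ψ' (LinearMap.range i)
  pos_iff : ∀ x : D, 0 < (x : Γ) ↔ 0 < i x
  map_psi : ∀ x c : D, ψ x = (c : Γ) → ψ' (i x) = i c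

namespace IsLogEmbedding

variable {D : Submodule ℚ Γ} {i : D →ₗ[ℚ] Γ'}

theorem lt_iff (hi : IsLogEmbedding ψ ψ' D i) (x y : D) : (x : Γ) < y ↔ i x < i y := by
  rw [← sub_pos, ← Submodule.coe_sub, hi.pos_iff, map_sub, sub_pos]

theorem map_succ (h : IsLogCouple ψ) (h' : IsLogCouple ψ') (hi : IsLogEmbedding ψ ψ' D i)
    {x c : D} (e : finSucc ψ x = c) : finSucc ψ' (i x) = i c := by
  apply h'.finSucc_eq
  rw [← map_sub]
  apply hi.map_psi
  rw [Submodule.coe_sub, ← e, h.psi_sub_finSucc]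

theorem exists_agree (hi : IsLogEmbedding ψ ψ' D i) (h : IsLogCouple ψ) {x : D} (hx : x ≠ 0) :
    ∃ c, Agree ψ ψ' D.subtype i x c := by
  obtain ⟨c, hc⟩ := h.exists_coe (α := (x : Γ)) (by simpa using hx)
  have hcD := hi.isLogSubspace.psi_mem x x.2 c hc
  exact ⟨⟨c, hcD⟩, hc, hi.map_psi x ⟨c, hcD⟩ hc, hi.pos_iff x⟩

end IsLogEmbedding

end Subspaces

/-! ### Chains of successors -/

section Chains

variable {Γ : Type u} [AddCommGroup Γ] [LinearOrder Γ] [IsOrderedAddMonoid Γ] [Module ℚ Γ]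
  {ψ : Γ → WithTop Γ} {D : Submodule ℚ Γ} {B : ℤ → Γ}

/-- A two-sided sequence of elements of `Ψ` outside `D`, each the successor of the previous
one. -/
structure IsSuccChain (ψ : Γ → WithTop Γ) (D : Submodule ℚ Γ) (B : ℤ → Γ) : Prop where
  mem : ∀ k, B k ∈ finPsi ψ
  notMem : ∀ k, B k ∉ D
  finSucc_eq : ∀ k, finSucc ψ (B k) = B (k + 1)

/-- The function `s` permutes `Ψ \ D`: closure of `D` under `p` keeps successors outside, and
predecessors exist because the least element `s 0` lies in `D`. The chain is the orbit of `b` under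
this permutation. -/
theorem IsLogSubspace.exists_chain (h : IsLogCouple ψ) (hD : IsLogSubspace ψ D) {b : Γ}
    (hb : b ∈ finPsi ψ) (hbD : b ∉ D) : ∃ B, IsSuccChain ψ D B ∧ B 0 = b := by
  let X : Type u := {x : Γ // x ∈ finPsi ψ ∧ x ∉ D}
  let f : X → X := fun x =>
    ⟨finSucc ψ x.1, h.finSucc_mem _, fun hx => x.2.2 (hD.pred_mem _ x.2.1 hx)⟩
  have hf : Function.Bijective f := by
    constructor
    · intro x y e
      exact Subtype.ext (h.finSucc_injOn x.2.1 y.2.1 (congrArg Subtype.val e))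
    · intro x
      have hlt : finSucc ψ 0 < x.1 := by
        refine lt_of_le_of_ne (h.finSucc_zero_le x.2.1) fun e => x.2.2 ?_
        rw [← e]
        exact hD.succ_mem 0 D.zero_mem
      obtain ⟨a, ha, e⟩ := h.exists_finSucc_eq x.2.1 hlt
      exact ⟨⟨a, ha, fun haD => x.2.2 (e ▸ hD.succ_mem a haD)⟩, Subtype.ext e⟩
  let e : Equiv.Perm X := Equiv.ofBijective f hf
  refine ⟨fun k => ((e ^ k) ⟨b, hb, hbD⟩).1, ⟨fun k => ((e ^ k) ⟨b, hb, hbD⟩).2.1,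
    fun k => ((e ^ k) ⟨b, hb, hbD⟩).2.2, fun k => ?_⟩, rfl⟩
  rw [add_comm, zpow_add, zpow_one]
  rfl

namespace IsSuccChain

theorem strictMono (h : IsLogCouple ψ) (hB : IsSuccChain ψ D B) : StrictMono B :=
  strictMono_int_of_lt_succ fun k => hB.finSucc_eq k ▸ h.lt_finSucc (hB.mem k)

theorem psi_sub (h : IsLogCouple ψ) (hB : IsSuccChain ψ D B) {k l : ℤ} (hkl : k < l) :
    ψ (B k - B l) = B (k + 1) := by
  rw [h.psi_sub_of_finSucc_lt, hB.finSucc_eq]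
  rw [hB.finSucc_eq, hB.finSucc_eq]
  exact hB.strictMono h (by lia)

theorem ne (hB : IsSuccChain ψ D B) {x : Γ} (hx : x ∈ D) (k : ℤ) : x ≠ B k :=
  fun e => hB.notMem k (e ▸ hx)

/-- No element of `Ψ` lies strictly between `B k` and its immediate successor, so `a` cannot
separate neighbours in the chain. -/
theorem lt_iff_of_mem (h : IsLogCouple ψ) (hB : IsSuccChain ψ D B) {a : Γ} (ha : a ∈ D)
    (haΨ : a ∈ finPsi ψ) (k l : ℤ) : a < B k ↔ a < B l := by
  have key : ∀ k, a < B (k + 1) ↔ a < B k := fun k => by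
    constructor
    · intro hlt
      by_contra hn
      have h1 := h.finSucc_le (hB.mem k) haΨ (lt_of_le_of_ne (not_lt.1 hn) (hB.ne ha k).symm)
      rw [hB.finSucc_eq] at h1
      exact absurd hlt (not_lt.2 h1)
    · exact fun hlt => hlt.trans (hB.strictMono h (by lia))
  have key0 : ∀ k : ℤ, a < B k ↔ a < B 0 := fun k => by
    induction k using Int.induction_on with
    | zero => rfl
    | succ k ih => rw [key, ih]
    | pred k ih =>
      have := key (-(k : ℤ) - 1)
      rw [sub_add_cancel] at this
      rw [← this, ih]
  rw [key0 k, key0 l]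

/-- This reduces the cut of the chain in `D` to elements of `Ψ ∩ D`. The exceptions `s x = B k` and
`s x = B (k + 1)` in `finSucc_lt_of_lt` are excluded since `s x ∈ D`. -/
theorem lt_iff_finSucc (h : IsLogCouple ψ) (hD : IsLogSubspace ψ D) (hB : IsSuccChain ψ D B)
    {x : Γ} (hx : x ∈ D) (k : ℤ) : x < B k ↔ finSucc ψ x < B k ∧ x < finSucc ψ x := by
  refine ⟨fun hlt => ⟨?_, h.lt_finSucc_of_lt (hB.mem k) hlt⟩, fun h1 => h1.2.trans h1.1⟩
  refine h.finSucc_lt_of_lt (hB.mem k) hlt (hB.ne (hD.succ_mem x hx) k) ?_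
  rw [hB.finSucc_eq]
  exact hB.ne (hD.succ_mem x hx) _

theorem lt_iff (h : IsLogCouple ψ) (hD : IsLogSubspace ψ D) (hB : IsSuccChain ψ D B)
    {x : Γ} (hx : x ∈ D) (k l : ℤ) : x < B k ↔ x < B l := by
  rw [hB.lt_iff_finSucc h hD hx, hB.lt_iff_finSucc h hD hx,
    hB.lt_iff_of_mem h (hD.succ_mem x hx) (h.finSucc_mem x) k l]

/-- One half of `ψ (B k - x) = min (s x) (B (k + 1))`; the next lemma is the other. The two entries
differ when `D` is closed under `s` and `x ∈ D`. -/
theorem psi_sub_of_lt (h : IsLogCouple ψ) (hB : IsSuccChain ψ D B) {x : Γ} {k : ℤ}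
    (hlt : finSucc ψ x < B (k + 1)) : ψ (B k - x) = finSucc ψ x := by
  rw [h.psi_sub_comm, h.psi_sub_of_finSucc_lt]
  rwa [hB.finSucc_eq]

theorem psi_sub_of_gt (h : IsLogCouple ψ) (hB : IsSuccChain ψ D B) {x : Γ} {k : ℤ}
    (hlt : B (k + 1) < finSucc ψ x) : ψ (B k - x) = B (k + 1) := by
  rw [h.psi_sub_of_finSucc_lt, hB.finSucc_eq]
  rwa [hB.finSucc_eq]

end IsSuccChain

end Chains

/-! ### Adjoining a chain -/

section AdjoinChain

variable {Γ : Type u} [AddCommGroup Γ] [LinearOrder Γ] [IsOrderedAddMonoid Γ] [Module ℚ Γ]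
  {Γ' : Type v} [AddCommGroup Γ'] [LinearOrder Γ'] [IsOrderedAddMonoid Γ'] [Module ℚ Γ']
  {D : Submodule ℚ Γ} {i : D →ₗ[ℚ] Γ'} {ψ' : Γ' → WithTop Γ'} {ψ : Γ → WithTop Γ}
  {B' : ℤ → Γ'} {B : ℤ → Γ}

/-- The linear map that extends `f` by sending the `k`-th generator to `B k`. -/
def chainMap {E : Type w} [AddCommGroup E] [Module ℚ E] (f : E →ₗ[ℚ] Γ) (B : ℤ → Γ) :
    E × (ℤ →₀ ℚ) →ₗ[ℚ] Γ :=
  f.coprod (Finsupp.linearCombination ℚ B)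

theorem chainMap_apply {E : Type w} [AddCommGroup E] [Module ℚ E] (f : E →ₗ[ℚ] Γ) (B : ℤ → Γ)
    (x : E) (c : ℤ →₀ ℚ) : chainMap f B (x, c) = f x + Finsupp.linearCombination ℚ B c :=
  rfl

theorem chainMap_single {E : Type w} [AddCommGroup E] [Module ℚ E] (f : E →ₗ[ℚ] Γ) (B : ℤ → Γ)
    (x : E) (k : ℤ) (q : ℚ) : chainMap f B (x, Finsupp.single k q) = f x + q • B k := by
  rw [chainMap_apply, Finsupp.linearCombination_single]

theorem chainMap_inl {E : Type w} [AddCommGroup E] [Module ℚ E] (f : E →ₗ[ℚ] Γ) (B : ℤ → Γ)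
    (x : E) : chainMap f B (x, 0) = f x := by
  rw [chainMap_apply, map_zero, add_zero]

theorem chainMap_inr {E : Type w} [AddCommGroup E] [Module ℚ E] (f : E →ₗ[ℚ] Γ) (B : ℤ → Γ)
    (k : ℤ) : chainMap f B (0, Finsupp.single k 1) = B k := by
  rw [chainMap_single, map_zero, zero_add, one_smul]

/-- Two chains that realize corresponding cuts. -/
structure ChainPair (ψ : Γ → WithTop Γ) (ψ' : Γ' → WithTop Γ') (D : Submodule ℚ Γ)
    (i : D →ₗ[ℚ] Γ') (B : ℤ → Γ) (B' : ℤ → Γ') : Prop where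
  left : IsSuccChain ψ D B
  right : IsSuccChain ψ' (LinearMap.range i) B'
  lt_iff : ∀ x : D, (x : Γ) < B 0 ↔ i x < B' 0

namespace ChainPair

/-- Each chain stays in one cut, so matching the cuts at index `0` matches them at every index. -/
theorem lt_iff' (h : IsLogCouple ψ) (h' : IsLogCouple ψ')
    (hi : IsLogEmbedding ψ ψ' D i) (hB : ChainPair ψ ψ' D i B B')
    (x : D) (k : ℤ) : (x : Γ) < B k ↔ i x < B' k := by
  rw [hB.left.lt_iff h hi.isLogSubspace x.2 k 0, hB.lt_iff,
    hB.right.lt_iff h' hi.isLogSubspace_range ⟨x, rfl⟩ 0 k]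

theorem bothLT_inl_inr (h : IsLogCouple ψ) (h' : IsLogCouple ψ')
    (hi : IsLogEmbedding ψ ψ' D i) (hB : ChainPair ψ ψ' D i B B')
    (x : D) (k : ℤ) :
    BothLT (chainMap D.subtype B) (chainMap i B') (x, 0) (0, Finsupp.single k 1) ∨
    BothLT (chainMap D.subtype B) (chainMap i B') (0, Finsupp.single k 1) (x, 0) := by
  simp only [BothLT, chainMap_inl, chainMap_inr, Submodule.subtype_apply]
  rcases lt_or_ge (x : Γ) (B k) with hlt | hge
  · exact Or.inl ⟨hlt, (hB.lt_iff' h h' hi x k).1 hlt⟩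
  · refine Or.inr ⟨lt_of_le_of_ne hge (hB.left.ne x.2 k).symm, lt_of_le_of_ne ?_
      (hB.right.ne ⟨x, rfl⟩ k).symm⟩
    exact not_lt.1 (mt (hB.lt_iff' h h' hi x k).2 (not_lt.2 hge))

theorem bothLT_inr_inr (h : IsLogCouple ψ) (h' : IsLogCouple ψ')
    (hB : ChainPair ψ ψ' D i B B') {k l : ℤ} (hkl : k < l) :
    BothLT (chainMap D.subtype B) (chainMap i B') (0, Finsupp.single k 1)
      (0, Finsupp.single l 1) := by
  simp only [BothLT, chainMap_inr]
  refine ⟨?_, hB.right.strictMono h' hkl⟩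
  exact hB.left.strictMono h hkl

/-- The case of an element of `D` plus a multiple of one element of the chain. -/
theorem agree_single (h : IsLogCouple ψ) (h' : IsLogCouple ψ')
    (hi : IsLogEmbedding ψ ψ' D i) (hB : ChainPair ψ ψ' D i B B')
    (x : D) (q : ℚ) (n : ℤ) (hne : x ≠ 0 ∨ q ≠ 0) :
    ∃ u : D × (ℤ →₀ ℚ), ((∃ a, u = (a, 0)) ∨ u = (0, Finsupp.single (n + 1) 1)) ∧
      Agree ψ ψ' (chainMap D.subtype B) (chainMap i B') (x, Finsupp.single n q) u := by
  rcases eq_or_ne q 0 with rfl | hq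
  · obtain ⟨c, hc⟩ := hi.exists_agree h (hne.resolve_right (by simp))
    refine ⟨(c, 0), Or.inl ⟨c, rfl⟩, ?_, ?_, ?_⟩ <;>
      simp only [Finsupp.single_zero, chainMap_inl]
    exacts [hc.left, hc.right, hc.pos_iff]
  -- Normalize: `x + q B n = q (B n - y)`, and a nonzero scalar does not change the value.
  let y : D := -(q⁻¹ • x)
  have hxy : ((x, Finsupp.single n q) : D × (ℤ →₀ ℚ)) = q • (-y, Finsupp.single n 1) := by
    ext1
    · simp [y, smul_smul, hq]
    · simp
  have e1 : chainMap D.subtype B (-y, Finsupp.single n 1) = B n - y := by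
    rw [chainMap_single, one_smul, map_neg, Submodule.subtype_apply, neg_add_eq_sub]
  have e2 : chainMap i B' (-y, Finsupp.single n 1) = B' n - i y := by
    rw [chainMap_single, one_smul, map_neg, neg_add_eq_sub]
  have hpos : 0 < B n - y ↔ 0 < B' n - i y := by
    rw [sub_pos, sub_pos, hB.lt_iff' h h' hi]
  let σ : D := ⟨finSucc ψ y, hi.isLogSubspace.succ_mem y y.2⟩
  have hσ : finSucc ψ' (i y) = i σ := hi.map_succ h h' rfl
  suffices hs : ∃ u : D × (ℤ →₀ ℚ), ((∃ a, u = (a, 0)) ∨ u = (0, Finsupp.single (n + 1) 1)) ∧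
      Agree ψ ψ' (chainMap D.subtype B) (chainMap i B') (-y, Finsupp.single n 1) u by
    obtain ⟨u, hu, hu'⟩ := hs
    exact ⟨u, hu, hxy ▸ hu'.smul h h' hq⟩
  -- The value of `B n - y` is the smaller of `s y` and `B (n + 1)`, and this comparison comes out
  -- alike on both sides.
  have hcases := hB.bothLT_inl_inr h h' hi σ (n + 1)
  simp only [BothLT, chainMap_inl, chainMap_inr, Submodule.subtype_apply] at hcases
  rcases hcases with hlt | hlt
  · refine ⟨(σ, 0), Or.inl ⟨σ, rfl⟩, ?_, ?_, ?_⟩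
    · rw [e1, chainMap_inl, hB.left.psi_sub_of_lt h hlt.1]
      rfl
    · rw [e2, chainMap_inl, hB.right.psi_sub_of_lt h' (hσ ▸ hlt.2), hσ]
    · rw [e1, e2, hpos]
  · refine ⟨(0, Finsupp.single (n + 1) 1), Or.inr rfl, ?_, ?_, ?_⟩
    · rw [e1, chainMap_inr, hB.left.psi_sub_of_gt h hlt.1]
    · rw [e2, chainMap_inr, hB.right.psi_sub_of_gt h' (hσ ▸ hlt.2)]
    · rw [e1, e2, hpos]

theorem agree_sub (h : IsLogCouple ψ) (h' : IsLogCouple ψ')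
    (hB : ChainPair ψ ψ' D i B B') {k n : ℤ} (hkn : k < n) :
    Agree ψ ψ' (chainMap D.subtype B) (chainMap i B')
      (0, Finsupp.single k 1 - Finsupp.single n 1) (0, Finsupp.single (k + 1) 1) := by
  have e : ((0, Finsupp.single k 1 - Finsupp.single n 1) : D × (ℤ →₀ ℚ)) =
      (0, Finsupp.single k 1) - (0, Finsupp.single n 1) := by simp
  constructor
  · rw [e, map_sub, chainMap_inr, chainMap_inr, chainMap_inr, hB.left.psi_sub h hkn]
  · rw [e, map_sub, chainMap_inr, chainMap_inr, chainMap_inr, hB.right.psi_sub h' hkn]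
  · rw [e, map_sub, map_sub, chainMap_inr, chainMap_inr, chainMap_inr, chainMap_inr, sub_pos,
      sub_pos]
    exact iff_of_false (hB.left.strictMono h hkn).not_gt (hB.right.strictMono h' hkn).not_gt

/-- The values of the elements of the extension. -/
theorem agree_add_sum (h : IsLogCouple ψ) (h' : IsLogCouple ψ')
    (hi : IsLogEmbedding ψ ψ' D i) (hB : ChainPair ψ ψ' D i B B')
    (x : D) (q : ℚ) {c : ℤ →₀ ℚ} (hc : c ≠ 0) {n : ℤ}
    (hn : ∀ k ∈ c.support, k < n) :
    ∃ u : D × (ℤ →₀ ℚ), ((∃ a, u = (a, 0)) ∨ ∃ k, u = (0, Finsupp.single k 1)) ∧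
      chainMap D.subtype B u < B (n + 1) ∧
      Agree ψ ψ' (chainMap D.subtype B) (chainMap i B') ((x, Finsupp.single n q) +
        ∑ k ∈ c.support, c k • (0, Finsupp.single k 1 - Finsupp.single n 1)) u := by
  -- The term `c k (B k - B n)` has value `B (k + 1)`; these values are distinct for distinct `k`,
  -- and they lie below `B (n + 1)`.
  obtain ⟨k, hk, hsum⟩ := Agree.sum (ψ := ψ) (ψ' := ψ') (Φ := chainMap D.subtype B)
    (Φ' := chainMap i B') h h' (Finsupp.support_nonempty_iff.2 hc)
    (f := fun k => c k • (0, Finsupp.single k 1 - Finsupp.single n 1))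
    (u := fun k => (0, Finsupp.single (k + 1) 1))
    (fun k hk => (hB.agree_sub h h' (hn k hk)).smul h h' (Finsupp.mem_support_iff.1 hk))
    (fun k _ l _ hkl => (lt_or_gt_of_ne hkl).imp
      (fun hlt => hB.bothLT_inr_inr h h' (by lia)) (fun hlt => hB.bothLT_inr_inr h h' (by lia)))
  have hkn := hn k hk
  have hlt : chainMap D.subtype B (0, Finsupp.single (k + 1) 1) < B (n + 1) := by
    rw [chainMap_inr]
    exact hB.left.strictMono h (by lia)
  by_cases hne : x ≠ 0 ∨ q ≠ 0
  · obtain ⟨u, hu, hu'⟩ := hB.agree_single h h' hi x q n hne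
    -- The value of `x + q B n` lies in `D` or equals `B (n + 1)`, so it never equals `B (k + 1)`
    -- with `k < n`.
    have hcmp : BothLT (chainMap D.subtype B) (chainMap i B') u (0, Finsupp.single (k + 1) 1) ∨
        BothLT (chainMap D.subtype B) (chainMap i B') (0, Finsupp.single (k + 1) 1) u := by
      rcases hu with ⟨a, rfl⟩ | rfl
      · exact hB.bothLT_inl_inr h h' hi a _
      · exact Or.inr (hB.bothLT_inr_inr h h' (by lia))
    rcases hcmp with hcmp | hcmp
    · exact ⟨u, hu.imp_right fun e => ⟨_, e⟩, hcmp.1.trans hlt, hu'.add_of_lt h h' hsum hcmp⟩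
    · refine ⟨_, Or.inr ⟨k + 1, rfl⟩, hlt, ?_⟩
      rw [add_comm]
      exact hsum.add_of_lt h h' hu' hcmp
  · obtain ⟨rfl, rfl⟩ : x = 0 ∧ q = 0 := by simpa using hne
    refine ⟨_, Or.inr ⟨k + 1, rfl⟩, hlt, ?_⟩
    rwa [Finsupp.single_zero, Prod.mk_zero_zero, zero_add]

/-- The chain elements themselves all have value `s 0`, so their values do not show what a
combination of them is worth. Differences with one `B n` beyond the support have distinct values. -/
theorem eq_add_sum (x : D) (c : ℤ →₀ ℚ) (n : ℤ) :
    (x, c) = (x, Finsupp.single n (∑ k ∈ c.support, c k)) +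
      ∑ k ∈ c.support, c k • ((0, Finsupp.single k 1 - Finsupp.single n 1) : D × (ℤ →₀ ℚ)) := by
  ext1
  · simp [Prod.fst_sum]
  · simp only [Prod.snd_add, Prod.snd_sum, Prod.smul_snd, smul_sub, Finsupp.smul_single,
      smul_eq_mul, mul_one, Finset.sum_sub_distrib]
    rw [← Finsupp.single_finsetSum, add_sub_cancel]
    exact (Finsupp.sum_single c).symm

/-- For an element using the chain, choose `n` beyond its support. Its difference with `B n` has
value below `B (n + 1) = s (B n)`, and by `finSucc_eq_of_psi_sub_lt` this value is the successor. -/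
theorem finSucc_chainMap (h : IsLogCouple ψ) (h' : IsLogCouple ψ')
    (hi : IsLogEmbedding ψ ψ' D i) (hB : ChainPair ψ ψ' D i B B')
    (w : D × (ℤ →₀ ℚ)) :
    ∃ u : D × (ℤ →₀ ℚ), ((∃ a, u = (a, 0)) ∨ ∃ k, u = (0, Finsupp.single k 1)) ∧
      finSucc ψ (chainMap D.subtype B w) = chainMap D.subtype B u := by
  obtain ⟨x, c⟩ := w
  rcases eq_or_ne c 0 with rfl | hc
  · refine ⟨(⟨finSucc ψ x, hi.isLogSubspace.succ_mem x x.2⟩, 0), Or.inl ⟨_, rfl⟩, ?_⟩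
    rw [chainMap_inl, chainMap_inl]
    rfl
  obtain ⟨n, hn⟩ : ∃ n : ℤ, ∀ k ∈ c.support, k < n := by
    obtain ⟨m, hm⟩ := c.support.bddAbove
    exact ⟨m + 1, fun k hk => Int.lt_add_one_of_le (hm hk)⟩
  -- Subtracting `B n` lowers its coefficient in `eq_add_sum` by `1`.
  obtain ⟨u, hu, hlt, hu'⟩ := hB.agree_add_sum h h' hi x (∑ k ∈ c.support, c k - 1) hc hn
  refine ⟨u, hu, h.finSucc_eq_of_psi_sub_lt (y := B n) ?_ (by rwa [hB.left.finSucc_eq])⟩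
  rw [← hu'.left, ← chainMap_inr D.subtype B n, ← map_sub]
  congr 2
  rw [eq_add_sum x c n, add_sub_right_comm]
  congr 1
  ext1 <;> simp

/-- Whether a combination belongs to `Ψ` is not visible from its coefficients. For predecessors, one
passes to its successor, which lies in `D` or in the chain, and then goes down twice. -/
theorem isParallel (h : IsLogCouple ψ) (h' : IsLogCouple ψ')
    (hi : IsLogEmbedding ψ ψ' D i) (hB : ChainPair ψ ψ' D i B B') :
    IsParallel ψ ψ' (chainMap D.subtype B) (chainMap i B') where
  agree := by
    rintro ⟨x, c⟩ hw
    rcases eq_or_ne c 0 with rfl | hc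
    · obtain ⟨u, -, hu⟩ := hB.agree_single h h' hi x 0 0 (Or.inl fun e => hw (by rw [e]; rfl))
      rw [Finsupp.single_zero] at hu
      exact ⟨u, hu⟩
    · obtain ⟨m, hm⟩ := c.support.bddAbove
      obtain ⟨u, -, -, hu⟩ := hB.agree_add_sum h h' hi x (∑ k ∈ c.support, c k) hc (n := m + 1)
        fun k hk => Int.lt_add_one_of_le (hm hk)
      rw [← eq_add_sum] at hu
      exact ⟨u, hu⟩
  succ w := by
    obtain ⟨u, -, hu⟩ := hB.finSucc_chainMap h h' hi w
    exact ⟨u, hu⟩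
  pred w hw hlt := by
    obtain ⟨u, ⟨a, rfl⟩ | ⟨k, rfl⟩, hu⟩ := hB.finSucc_chainMap h h' hi w
    · rw [chainMap_inl] at hu
      obtain ⟨z, hz, e⟩ := h.exists_finSucc_eq hw hlt
      have hwD := hi.isLogSubspace.pred_mem _ hw (hu ▸ a.2)
      have hzD := hi.isLogSubspace.pred_mem _ hz (e ▸ hwD)
      refine ⟨(⟨z, hzD⟩, 0), ?_⟩
      rw [chainMap_inl]
      exact ⟨hz, e⟩
    · rw [chainMap_inr] at hu
      -- The given element has successor `B k`, so it is `B (k - 1)`, and its predecessor is `B (k -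
      -- 2)`.
      refine ⟨(0, Finsupp.single (k - 2) 1), ?_⟩
      rw [chainMap_inr]
      refine ⟨hB.left.mem _, h.finSucc_injOn (h.finSucc_mem _) hw ?_⟩
      rw [hu, hB.left.finSucc_eq, hB.left.finSucc_eq]
      congr 1
      lia

end ChainPair

end AdjoinChain

/-! ### Adjoining one element -/

section AdjoinElement

variable {Γ : Type u} [AddCommGroup Γ] [LinearOrder Γ] [IsOrderedAddMonoid Γ] [Module ℚ Γ]
  {Γ' : Type v} [AddCommGroup Γ'] [LinearOrder Γ'] [IsOrderedAddMonoid Γ'] [Module ℚ Γ']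
  {D : Submodule ℚ Γ} {i : D →ₗ[ℚ] Γ'} {ψ' : Γ' → WithTop Γ'} {ψ : Γ → WithTop Γ}

/-- All values, successors and predecessors already lie in `D`. Up to a nonzero scalar, an element
outside `D` is `α - y` with `y ∈ D`, so only the cut of `α` and the values `ψ (α - y)` have to
match. -/
theorem isParallel_of_finPsi_subset (h : IsLogCouple ψ) (h' : IsLogCouple ψ')
    (hi : IsLogEmbedding ψ ψ' D i) (hΨ : ∀ b ∈ finPsi ψ, b ∈ D) {α : Γ} {α' : Γ'}
    (hα : ∀ x : D, (x : Γ) < α ↔ i x < α')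
    (hα' : ∀ x : D, ∃ c : D, ψ (α - x) = (c : Γ) ∧ ψ' (α' - i x) = i c) :
    IsParallel ψ ψ' (D.subtype.coprod (LinearMap.toSpanSingleton ℚ Γ α))
      (i.coprod (LinearMap.toSpanSingleton ℚ Γ' α')) where
  agree := by
    rintro ⟨x, q⟩ hw
    rcases eq_or_ne q 0 with rfl | hq
    · obtain ⟨c, hc⟩ := hi.exists_agree h (x := x) fun e => hw (by rw [e]; rfl)
      refine ⟨(c, 0), ?_, ?_, ?_⟩ <;>
        simp only [LinearMap.coprod_apply, map_zero, add_zero]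
      exacts [hc.left, hc.right, hc.pos_iff]
    let y : D := -(q⁻¹ • x)
    have hxy : (x, q) = q • ((-y, 1) : D × ℚ) := by
      ext1
      · simp [y, smul_smul, hq]
      · simp
    obtain ⟨c, hc, hc'⟩ := hα' y
    refine ⟨(c, 0), ?_⟩
    rw [hxy]
    refine Agree.smul h h' ⟨?_, ?_, ?_⟩ hq <;>
      simp only [LinearMap.coprod_apply, map_zero, add_zero, LinearMap.toSpanSingleton_apply,
        one_smul, map_neg, neg_add_eq_sub]
    · exact hc
    · exact hc'
    · rw [sub_pos, sub_pos, ← hα]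
      rfl
  succ w := ⟨(⟨_, hΨ _ (h.finSucc_mem _)⟩, 0), by
    simp only [LinearMap.coprod_apply, map_zero, add_zero]
    rfl⟩
  pred w hw hlt := by
    obtain ⟨z, hz, e⟩ := h.exists_finSucc_eq hw hlt
    refine ⟨(⟨z, hΨ z hz⟩, 0), ?_⟩
    rw [LinearMap.coprod_apply _ _ ((⟨z, hΨ z hz⟩, 0) : D × ℚ), map_zero, add_zero]
    exact ⟨hz, e⟩

/-- If `b = s a`, then `a - b` has value `b`, and `a ∈ D` by closure under `p`; for the least
element take `a = 0`. -/
theorem IsLogSubspace.exists_psi_eq (h : IsLogCouple ψ) (hD : IsLogSubspace ψ D) {b : Γ}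
    (hb : b ∈ finPsi ψ) (hbD : b ∈ D) : ∃ x ∈ D, ψ x = b := by
  rcases (h.finSucc_zero_le hb).eq_or_lt with e | hlt
  · exact ⟨0 - b, D.sub_mem D.zero_mem hbD, e ▸ h.psi_sub_finSucc 0⟩
  · obtain ⟨a, ha, e⟩ := h.exists_finSucc_eq hb hlt
    exact ⟨a - b, D.sub_mem (hD.pred_mem a ha (e ▸ hbD)) hbD, e ▸ h.psi_sub_finSucc a⟩

/-- An element is approximated by elements of a subspace that contains `Ψ`. -/
theorem IsLogSubspace.exists_approx (h : IsLogCouple ψ) (hD : IsLogSubspace ψ D)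
    (hΨ : ∀ b ∈ finPsi ψ, b ∈ D) {α : Γ} (hα : α ∉ D) (F : Finset D) :
    ∃ x : D, ∀ y ∈ F, ψ (x - y) = ψ (α - y) ∧ ((y : Γ) < x ↔ y < α) := by
  classical
  rcases F.eq_empty_or_nonempty with rfl | hF
  · exact ⟨0, by simp⟩
  have hne : ∀ y : D, (y : Γ) ≠ α := fun y e => hα (e ▸ y.2)
  obtain ⟨y₀, -, hmax⟩ := F.exists_max_image (fun y : D => ψ (α - y)) hF
  -- An `x` closer to `α` than `y` is looks like `α` from `y`.
  have close : ∀ x y : D, ψ (α - y) < ψ (x - α) →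
      ψ (x - y) = ψ (α - y) ∧ ((y : Γ) < x ↔ y < α) := fun x y hlt => by
    have e : (x - y : Γ) = (α - y) + (x - α) := by abel
    refine ⟨by rw [e, h.psi_add_of_lt hlt], ?_⟩
    rw [← sub_pos, e, h.add_pos_iff hlt, sub_pos]
  by_cases hc : ∃ x : D, ψ (α - y₀) < ψ (α - x)
  · obtain ⟨x, hx⟩ := hc
    refine ⟨x, fun y hy => close x y ?_⟩
    rw [h.psi_sub_comm (x : Γ)]
    exact (hmax y hy).trans_lt hx
  obtain ⟨c, hc'⟩ := h.exists_coe (α := α - y₀) (sub_ne_zero.2 (hne y₀).symm)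
  simp only [hc'] at hmax hc
  -- Now no element of `D` comes closer to `α` than the value `c`. For `y` at value exactly `c`, it
  -- suffices that `x` lies on the same side of `y` as `α`, at distance at least `d`: then `ψ (x -
  -- y) ≤ ψ d ≤ c` by `H`-type, and `ψ (x - y) ≥ c` holds anyway.
  suffices key : ∃ x d : D, 0 < (d : Γ) ∧ ψ d ≤ c ∧ c ≤ ψ (x - α) ∧ ∀ y ∈ F, ψ (α - y) = c →
      ((y : Γ) < α → (y : Γ) + d ≤ x) ∧ (α < y → (x : Γ) + d ≤ y) by
    obtain ⟨x, d, hd, hdc, hx, hy⟩ := key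
    refine ⟨x, fun y hyF => ?_⟩
    rcases (hmax y hyF).lt_or_eq with hlt | heq
    · exact close x y (hlt.trans_le hx)
    have h1 : c ≤ ψ (x - y : Γ) := by
      rw [← sub_add_sub_cancel (x : Γ) α y]
      exact h.le_psi_add hx heq.ge
    rw [heq]
    rcases lt_or_gt_of_ne (hne y) with hlt | hlt
    · have h2 := (hy y hyF heq).1 hlt
      have h3 := h.psi_anti hd.le (le_sub_iff_add_le'.2 h2)
      exact ⟨le_antisymm (h3.trans hdc) h1,
        iff_of_true ((lt_add_of_pos_right _ hd).trans_le h2) hlt⟩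
    · have h2 := (hy y hyF heq).2 hlt
      have h3 := h.psi_anti hd.le (le_sub_iff_add_le'.2 h2)
      rw [h.psi_sub_comm] at h3
      exact ⟨le_antisymm (h3.trans hdc) h1,
        iff_of_false ((lt_add_of_pos_right _ hd).trans_le h2).not_gt hlt.not_gt⟩
  obtain ⟨e, heD, hepos, he⟩ : ∃ e ∈ D, 0 < e ∧ ψ e = c := by
    have hcΨ : c ∈ finPsi ψ := ⟨_, hc'⟩
    obtain ⟨e, heD, he⟩ := hD.exists_psi_eq h hcΨ (hΨ c hcΨ)
    rcases lt_or_gt_of_ne (h.ne_zero (he ▸ WithTop.coe_ne_top)) with hlt | hlt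
    · exact ⟨-e, D.neg_mem heD, neg_pos.2 hlt, by rw [h.psi_neg, he]⟩
    · exact ⟨e, heD, hlt, he⟩
  -- Only the nearest points of `F` at value `c` below and above `α` matter.
  have lower : (∀ y ∈ F, ψ (α - y) = c → ¬ (y : Γ) < α) ∨
      ∃ l : D, (l : Γ) < α ∧ ψ (l - α) = c ∧ ∀ y ∈ F, ψ (α - y) = c → (y : Γ) < α → y ≤ l := by
    rcases (F.filter fun y : D => ψ (α - y) = c ∧ (y : Γ) < α).eq_empty_or_nonempty with h0 | h0
    · exact Or.inl fun y hy e hlt => Finset.notMem_empty y (h0 ▸ Finset.mem_filter.2 ⟨hy, e, hlt⟩)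
    · obtain ⟨l, hl, hl'⟩ := Finset.exists_max_image _ id h0
      obtain ⟨-, h1, h2⟩ := Finset.mem_filter.1 hl
      exact Or.inr ⟨l, h2, by rw [h.psi_sub_comm, h1],
        fun y hy e hlt => hl' y (Finset.mem_filter.2 ⟨hy, e, hlt⟩)⟩
  have upper : (∀ y ∈ F, ψ (α - y) = c → ¬ α < y) ∨
      ∃ u : D, α < u ∧ ψ (u - α) = c ∧ ∀ y ∈ F, ψ (α - y) = c → α < y → u ≤ y := by
    rcases (F.filter fun y : D => ψ (α - y) = c ∧ α < y).eq_empty_or_nonempty with h0 | h0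
    · exact Or.inl fun y hy e hlt => Finset.notMem_empty y (h0 ▸ Finset.mem_filter.2 ⟨hy, e, hlt⟩)
    · obtain ⟨l, hl, hl'⟩ := Finset.exists_min_image _ id h0
      obtain ⟨-, h1, h2⟩ := Finset.mem_filter.1 hl
      exact Or.inr ⟨l, h2, by rw [h.psi_sub_comm, h1],
        fun y hy e hlt => hl' y (Finset.mem_filter.2 ⟨hy, e, hlt⟩)⟩
  rcases lower with hl | ⟨l, hl, hlc, hl'⟩
  · rcases upper with hu | ⟨u, hu, huc, hu'⟩
    · refine ⟨y₀, ⟨e, heD⟩, hepos, he.le, by rw [h.psi_sub_comm, hc'], fun y hy e => ?_⟩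
      exact ⟨fun h1 => absurd h1 (hl y hy e), fun h1 => absurd h1 (hu y hy e)⟩
    · refine ⟨u - ⟨e, heD⟩, ⟨e, heD⟩, hepos, he.le, ?_, fun y hy e => ?_⟩
      · rw [Submodule.coe_sub, sub_right_comm]
        exact h.le_psi_sub huc.ge he.ge
      · refine ⟨fun h1 => absurd h1 (hl y hy e), fun h1 => ?_⟩
        rw [Submodule.coe_sub, sub_add_cancel]
        exact hu' y hy e h1
  · rcases upper with hu | ⟨u, hu, huc, hu'⟩
    · refine ⟨l + ⟨e, heD⟩, ⟨e, heD⟩, hepos, he.le, ?_, fun y hy e => ?_⟩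
      · rw [Submodule.coe_add, add_sub_right_comm]
        exact h.le_psi_add hlc.ge he.ge
      · refine ⟨fun h1 => ?_, fun h1 => absurd h1 (hu y hy e)⟩
        rw [Submodule.coe_add]
        exact add_le_add_left (hl' y hy e h1) _
    -- With neighbours on both sides take the midpoint, and for `d` half the gap; `0 < u - α < u -
    -- l` gives `ψ (u - l) ≤ c`. With one neighbour, `x` was that neighbour moved by `e` towards
    -- `α`.
    · have hhalf : ∀ x : Γ, (2⁻¹ : ℚ) • x + (2⁻¹ : ℚ) • x = x := fun x => by
        rw [← add_smul]
        norm_num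
      have e1 : ((l + (2⁻¹ : ℚ) • (u - l) : D) : Γ) + ((2⁻¹ : ℚ) • (u - l) : D) = u := by
        simp only [Submodule.coe_add, Submodule.coe_smul, Submodule.coe_sub]
        rw [add_assoc, hhalf, add_sub_cancel]
      have e2 : ((u - l : D) : Γ) = (u - α) - (l - α) := by
        rw [Submodule.coe_sub]
        abel
      have hψ : ψ ((2⁻¹ : ℚ) • ((u - l : D) : Γ)) = ψ ((u - l : D) : Γ) :=
        h.psi_smul (by norm_num) _
      refine ⟨l + (2⁻¹ : ℚ) • (u - l), (2⁻¹ : ℚ) • (u - l), ?_, ?_, ?_, fun y hy e => ⟨?_, ?_⟩⟩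
      · rw [Submodule.coe_smul, pos_smul_iff (by norm_num), Submodule.coe_sub, sub_pos]
        exact hl.trans hu
      · rw [Submodule.coe_smul, hψ, ← huc]
        exact h.psi_anti (sub_nonneg.2 hu.le) (sub_le_sub_left hl.le _)
      · rw [Submodule.coe_add, add_sub_right_comm]
        refine h.le_psi_add hlc.ge ?_
        rw [Submodule.coe_smul, hψ, e2]
        exact h.le_psi_sub huc.ge hlc.ge
      · intro h1
        rw [Submodule.coe_add]
        exact add_le_add_left (hl' y hy e h1) _
      · intro h1
        rw [e1]
        exact hu' y hy e h1

end AdjoinElement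

/-! ### Substructures and embeddings -/

section ModelTheory

open FirstOrder.Language FirstOrder.Language.Structure

theorem isQF_ltF {n : ℕ} (t₁ t₂ : Llog.Term (Empty ⊕ Fin n)) : (ltF t₁ t₂).IsQF :=
  (BoundedFormula.IsAtomic.rel _ _).isQF

theorem isQF_bdEqual {n : ℕ} (t₁ t₂ : Llog.Term (Empty ⊕ Fin n)) : (t₁ =' t₂).IsQF :=
  (BoundedFormula.IsAtomic.equal _ _).isQF

theorem isQF_leF {n : ℕ} (t₁ t₂ : Llog.Term (Empty ⊕ Fin n)) : (leF t₁ t₂).IsQF :=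
  (isQF_ltF _ _).sup (isQF_bdEqual _ _)

theorem isQF_finF {n : ℕ} (t : Llog.Term (Empty ⊕ Fin n)) : (finF t).IsQF :=
  (isQF_bdEqual _ _).not

theorem isQF_nzF {n : ℕ} (t : Llog.Term (Empty ⊕ Fin n)) : (nzF t).IsQF :=
  (isQF_bdEqual _ _).not.inf (isQF_bdEqual _ _).not

theorem isQF_inPsiF {n : ℕ} (t : Llog.Term (Empty ⊕ Fin n)) : (inPsiF t).IsQF :=
  (isQF_finF _).inf ((isQF_bdEqual _ _).sup (isQF_bdEqual _ _))

/-- Division, integrals `x - s x` and predecessors are given by terms, so no axiom needs an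
existential quantifier. Hence substructures of models are models. -/
instance isUniversal_Tlog : Tlog.IsUniversal where
  isUniversal_of_mem := by
    rintro _ ⟨a, rfl⟩
    cases a <;> (repeat' apply BoundedFormula.IsUniversal.all) <;>
      apply BoundedFormula.IsUniversal.of_isQF <;>
      repeat' first
        | apply isQF_ltF | apply isQF_leF | apply isQF_finF | apply isQF_nzF | apply isQF_inPsiF
        | apply isQF_bdEqual | apply BoundedFormula.IsQF.not | apply BoundedFormula.IsQF.imp

/-- Two maps from a set into structures such that the functions and relations agree on their
images give an embedding of a substructure. -/
theorem exists_embedding_of_agree {L : FirstOrder.Language.{0, 0}} {M : Type u} {N : Type v}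
    [L.Structure M] [L.Structure N] {T : Type w} (a : T → M) (b : T → N)
    (hfun : ∀ (n : ℕ) (f : L.Functions n) (t : Fin n → T),
      ∃ r, funMap f (fun k => a (t k)) = a r ∧ funMap f (fun k => b (t k)) = b r)
    (hrel : ∀ (n : ℕ) (R : L.Relations n) (t : Fin n → T),
      RelMap R (fun k => a (t k)) ↔ RelMap R (fun k => b (t k)))
    (ha : Function.Injective a) (hb : Function.Injective b) :
    ∃ (S : L.Substructure M), (∀ t, a t ∈ S) ∧
      ∃ j : S ↪[L] N, ∀ t (ht : a t ∈ S), j ⟨a t, ht⟩ = b t := by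
  let S : L.Substructure M :=
    { carrier := Set.range a
      fun_mem := fun {n} f x hx => by
        choose t ht using hx
        obtain ⟨r, hr, -⟩ := hfun n f t
        exact ⟨r, by rw [← hr]; congr 1; exact funext ht⟩ }
  let c : S → T := fun x => Classical.choose x.2
  have hc : ∀ x : S, a (c x) = x := fun x => Classical.choose_spec x.2
  have hca : ∀ t (ht : a t ∈ S), c ⟨a t, ht⟩ = t := fun t ht => ha (hc ⟨a t, ht⟩)
  have hx : ∀ (n : ℕ) (x : Fin n → S), (fun k => ((x k : S) : M)) = fun k => a (c (x k)) :=
    fun n x => funext fun k => (hc (x k)).symm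
  refine ⟨S, fun t => ⟨t, rfl⟩, ⟨⟨⟨fun x => b (c x), fun x y e => ?_⟩, ?_, ?_⟩, fun t ht => ?_⟩⟩
  · rw [Subtype.ext_iff, ← hc x, ← hc y, hb e]
  · intro n f x
    obtain ⟨r, hr, hr'⟩ := hfun n f fun k => c (x k)
    have e : ((funMap f x : S) : M) = a r := by
      rw [← hr, ← hx]
      rfl
    have e' : c (funMap f x) = r := ha (by rw [hc, e])
    change b (c (funMap f x)) = funMap f fun k => b (c (x k))
    rw [e', hr']
  · intro n R x
    change RelMap R (fun k => b (c (x k))) ↔ RelMap R fun k => (x k : M)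
    rw [hx, hrel]
  · exact congrArg b (hca t ht)

/-- Saturation, for families of formulas indexed by the parameters. -/
theorem IsSaturated.exists_realize {L : FirstOrder.Language.{0, 0}} {N : Type v} [L.Structure N]
    {N' : Type v} [L.Structure N'] (e : N ≃[L] N') {κ : Cardinal.{u}} (hsat : IsSaturated L N κ)
    {P : Type u} (hP : #P < κ) (a : P → N') (φ : P → L.Formula (P ⊕ Fin 1))
    (hφ : ∀ F : Finset P, ∃ x : N', ∀ p ∈ F, (φ p).Realize (Sum.elim a fun _ => x)) :
    ∃ x : N', ∀ p, (φ p).Realize (Sum.elim a fun _ => x) := by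
  classical
  -- The parameters are moved to `N`, where saturation is assumed; their set has at most `#P`
  -- elements.
  let g : P → N := fun p => e.symm (a p)
  let A : Set N := Set.range g
  let θ : P → L[[A]].Formula (Fin 1) := fun p =>
    BoundedFormula.constantsVarsEquiv.symm
      ((φ p).relabel (Sum.map (fun p => (⟨g p, p, rfl⟩ : A)) id))
  have key : ∀ p x, (θ p).Realize (fun _ => x) ↔ (φ p).Realize (Sum.elim a fun _ => e x) := by
    intro p x
    rw [Formula.Realize, ← BoundedFormula.realize_constantsVarsEquiv]
    change BoundedFormula.Realize (BoundedFormula.constantsVarsEquiv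
      (BoundedFormula.constantsVarsEquiv.symm _)) _ _ ↔ _
    rw [Equiv.apply_symm_apply]
    change Formula.Realize _ _ ↔ _
    rw [Formula.realize_relabel, ← StrongHomClass.realize_formula e]
    refine iff_of_eq (congrArg _ (funext fun y => ?_))
    rcases y with y | y
    · exact e.apply_symm_apply (a y)
    · rfl
  have hA : Cardinal.lift.{u} #A < Cardinal.lift.{v} κ :=
    mk_range_le_lift.trans_lt (Cardinal.lift_lt.2 hP)
  obtain ⟨x, hx⟩ := hsat A hA (Set.range θ) fun q hq => by
    obtain ⟨F, rfl⟩ : ∃ F : Finset P, F.image θ = q := by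
      rw [← Set.image_univ] at hq
      obtain ⟨F, -, hF⟩ := Finset.subset_set_image_iff.1 hq
      exact ⟨F, hF⟩
    obtain ⟨x, hx⟩ := hφ F
    refine ⟨e.symm x, fun ψ hψ => ?_⟩
    obtain ⟨p, hp, rfl⟩ := Finset.mem_image.1 hψ
    rw [key, e.apply_symm_apply]
    exact hx p hp
  exact ⟨e x, fun p => (key p x).1 (hx _ ⟨p, rfl⟩)⟩

end ModelTheory

/-! ### Extending a partial embedding -/

section Extension

open FirstOrder.Language FirstOrder.Language.Structure

variable {Γ : Type u} [AddCommGroup Γ] [LinearOrder Γ] [IsOrderedAddMonoid Γ] [Module ℚ Γ]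
  {Γ' : Type v} [AddCommGroup Γ'] [LinearOrder Γ'] [IsOrderedAddMonoid Γ'] [Module ℚ Γ']
  {D : Submodule ℚ Γ} {i : D →ₗ[ℚ] Γ'} {ψ' : Γ' → WithTop Γ'} {ψ : Γ → WithTop Γ}

/-- Finitely satisfiable families of formulas with parameters `a p` are realized in the couple,
where the families are indexed by the parameters. -/
def RealizesTypes {P : Type u} (ψ' : Γ' → WithTop Γ') (a : P → Γ') : Prop :=
  letI := coupleStructure ψ'
  ∀ φ : P → Llog.Formula (P ⊕ Fin 1),
    (∀ F : Finset P, ∃ x : WithTop Γ', ∀ p ∈ F,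
      (φ p).Realize (Sum.elim (fun p => (a p : WithTop Γ')) fun _ => x)) →
    ∃ x : WithTop Γ', ∀ p, (φ p).Realize (Sum.elim (fun p => (a p : WithTop Γ')) fun _ => x)

theorem realize_lt {β : Type w} (t₁ t₂ : Llog.Term β) (a : β → WithTop Γ') :
    letI := coupleStructure ψ'
    ((Relations.formula₂ (L := Llog) LogRel.lt t₁ t₂).Realize a ↔ t₁.realize a < t₂.realize a) := by
  let := coupleStructure ψ'
  exact Formula.realize_rel₂

theorem realize_psi {β : Type w} (t : Llog.Term β) (a : β → WithTop Γ') :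
    letI := coupleStructure ψ'
    (Functions.apply₁ (L := Llog) LogFunc.psi t).realize a = extendTop ψ' (t.realize a) := by
  let := coupleStructure ψ'
  exact Term.realize_functions_apply₁

theorem realize_sub {β : Type w} (s t : β) (a : β → WithTop Γ') :
    letI := coupleStructure ψ'
    (Functions.apply₂ (L := Llog) LogFunc.add (Term.var s)
      (Functions.apply₁ (L := Llog) LogFunc.neg (Term.var t))).realize a =
        a s + extendTop (fun x => ((-x : Γ') : WithTop Γ')) (a t) := by
  let := coupleStructure ψ'
  have h1 : (Functions.apply₁ (L := Llog) LogFunc.neg (Term.var t)).realize a =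
      extendTop (fun x => ((-x : Γ') : WithTop Γ')) (a t) := Term.realize_functions_apply₁
  rw [← h1]
  exact Term.realize_functions_apply₂

/-- A cut in a subspace that is realized by an element of `Ψ` outside it is also realized by an
element of `Ψ` on the other side. -/
theorem IsLogEmbedding.exists_cut (h : IsLogCouple ψ) (hi : IsLogEmbedding ψ ψ' D i)
    (hsat : RealizesTypes ψ' i) {b : Γ} (hb : b ∈ finPsi ψ) (hbD : b ∉ D) :
    ∃ b' ∈ finPsi ψ', ∀ x : D, ((x : Γ) < b → i x < b') ∧ (b < x → b' < i x) := by
  classical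
  let := coupleStructure ψ'
  obtain ⟨B, hB, rfl⟩ := hi.isLogSubspace.exists_chain h hb hbD
  -- The unknown enters only through `ψ`, so that a realization yields an element of `Ψ`; the first
  -- conjunct of `φ` excludes `∞`.
  let y : Llog.Term (D ⊕ Fin 1) := Functions.apply₁ (L := Llog) LogFunc.psi (Term.var (Sum.inr 0))
  let φ : D → Llog.Formula (D ⊕ Fin 1) := fun x =>
    Relations.formula₂ (L := Llog) LogRel.lt y
      (Constants.term (L := Llog) LogFunc.infty) ⊓
    if (x : Γ) < B 0 then Relations.formula₂ (L := Llog) LogRel.lt (Term.var (Sum.inl x)) y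
    else Relations.formula₂ (L := Llog) LogRel.lt y (Term.var (Sum.inl x))
  have hφ : ∀ (x : D) (z : WithTop Γ'),
      (φ x).Realize (Sum.elim (fun x => (i x : WithTop Γ')) fun _ => z) ↔
        extendTop ψ' z < ⊤ ∧ if (x : Γ) < B 0 then (i x : WithTop Γ') < extendTop ψ' z else
          extendTop ψ' z < i x := by
    intro x z
    have ht : (Constants.term (L := Llog) (α := D ⊕ Fin 1) LogFunc.infty).realize
        (Sum.elim (fun x => (i x : WithTop Γ')) fun _ => z) = ⊤ := Term.realize_constants
    rw [Formula.realize_inf, realize_lt, realize_psi, ht]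
    refine and_congr_right fun _ => ?_
    split_ifs <;> rw [realize_lt, realize_psi] <;> rfl
  obtain ⟨z, hz⟩ := hsat φ fun F => by
    -- For `x ∈ D` below the cut, `x < s x < B 0`; so the largest of `s 0` and finitely many such `s
    -- x` is a suitable `a ∈ Ψ ∩ D`.
    obtain ⟨a, haΨ, hab, ha⟩ : ∃ a : D, (a : Γ) ∈ finPsi ψ ∧ (a : Γ) < B 0 ∧
        ∀ x ∈ F, (x : Γ) < B 0 → x < a := by
      induction F using Finset.induction_on with
      | empty =>
        refine ⟨⟨finSucc ψ 0, hi.isLogSubspace.succ_mem 0 D.zero_mem⟩, h.finSucc_mem 0,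
          lt_of_le_of_ne (h.finSucc_zero_le hb) (hB.ne ?_ 0), by simp⟩
        exact hi.isLogSubspace.succ_mem 0 D.zero_mem
      | insert x F _ ih =>
        obtain ⟨a, haΨ, hab, ha⟩ := ih
        by_cases hx : (x : Γ) < B 0
        · obtain ⟨h1, h2⟩ := (hB.lt_iff_finSucc h hi.isLogSubspace x.2 0).1 hx
          rcases le_total (finSucc ψ x) a with h3 | h3
          · refine ⟨a, haΨ, hab, fun y hy hyb => ?_⟩
            rcases Finset.mem_insert.1 hy with rfl | hy
            · exact h2.trans_le h3
            · exact ha y hy hyb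
          · refine ⟨⟨finSucc ψ x, hi.isLogSubspace.succ_mem x x.2⟩, h.finSucc_mem _, h1,
              fun y hy hyb => ?_⟩
            rcases Finset.mem_insert.1 hy with rfl | hy
            · exact h2
            · exact (ha y hy hyb).trans_le h3
        · refine ⟨a, haΨ, hab, fun y hy hyb => ?_⟩
          rcases Finset.mem_insert.1 hy with rfl | hy
          · exact absurd hyb hx
          · exact ha y hy hyb
    obtain ⟨z, hzD, hz⟩ := hi.isLogSubspace.exists_psi_eq h haΨ a.2
    refine ⟨i ⟨z, hzD⟩, fun x hx => ?_⟩
    rw [hφ, extendTop_coe, hi.map_psi ⟨z, hzD⟩ a hz]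
    refine ⟨WithTop.coe_lt_top _, ?_⟩
    split_ifs with hxb
    · exact_mod_cast (hi.lt_iff x a).1 (ha x hx hxb)
    · exact_mod_cast (hi.lt_iff a x).1 (hab.trans_le (not_lt.1 hxb))
  simp only [hφ] at hz
  induction z using WithTop.recTopCoe with
  | top => exact absurd (hz 0).1 (lt_irrefl _)
  | coe z =>
    simp only [extendTop_coe] at hz
    obtain ⟨b', hb'⟩ := WithTop.ne_top_iff_exists.1 (hz 0).1.ne
    refine ⟨b', ⟨z, hb'.symm⟩, fun x => ⟨fun hx => ?_, fun hx => ?_⟩⟩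
    · have := (hz x).2
      rw [if_pos hx, ← hb'] at this
      exact_mod_cast this
    · have := (hz x).2
      rw [if_neg hx.not_gt, ← hb'] at this
      exact_mod_cast this

/-- If `D` contains `Ψ`, then the type of an element over `D` is realized on the other side. -/
theorem IsLogEmbedding.exists_type (h : IsLogCouple ψ)
    (hi : IsLogEmbedding ψ ψ' D i) (hsat : RealizesTypes ψ' i) (hΨ : ∀ b ∈ finPsi ψ, b ∈ D)
    {α : Γ} (hα : α ∉ D) :
    ∃ α' : Γ', (∀ x : D, (x : Γ) < α ↔ i x < α') ∧
      ∀ x : D, ∃ c : D, ψ (α - x) = (c : Γ) ∧ ψ' (α' - i x) = i c := by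
  classical
  let := coupleStructure ψ'
  have hne : ∀ x : D, α - x ≠ 0 := fun x e => hα (sub_eq_zero.1 e ▸ x.2)
  have hc : ∀ x : D, ∃ c : D, ψ (α - x) = (c : Γ) := fun x => by
    obtain ⟨c, hc⟩ := h.exists_coe (hne x)
    exact ⟨⟨c, hΨ c ⟨_, hc⟩⟩, hc⟩
  choose c hc using hc
  let y : Llog.Term (D ⊕ Fin 1) := Term.var (Sum.inr 0)
  let φ : D → Llog.Formula (D ⊕ Fin 1) := fun x =>
    (if (x : Γ) < α then Relations.formula₂ (L := Llog) LogRel.lt (Term.var (Sum.inl x)) y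
      else Relations.formula₂ (L := Llog) LogRel.lt y (Term.var (Sum.inl x))) ⊓
    Term.equal (Functions.apply₁ (L := Llog) LogFunc.psi
      (Functions.apply₂ (L := Llog) LogFunc.add y
        (Functions.apply₁ (L := Llog) LogFunc.neg (Term.var (Sum.inl x)))))
      (Term.var (Sum.inl (c x)))
  have hφ : ∀ (x : D) (z : Γ'),
      (φ x).Realize (Sum.elim (fun x => (i x : WithTop Γ')) fun _ => (z : WithTop Γ')) ↔
        (if (x : Γ) < α then i x < z else z < i x) ∧ ψ' (z - i x) = i (c x) := by
    intro x z
    rw [Formula.realize_inf, Formula.realize_equal, realize_psi,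
      realize_sub (Sum.inr 0) (Sum.inl x), sub_eq_add_neg]
    refine and_congr ?_ Iff.rfl
    split_ifs <;> rw [realize_lt]
    exacts [WithTop.coe_lt_coe, WithTop.coe_lt_coe]
  -- The condition on `ψ` at the parameter `0` excludes `∞` as a realization.
  have hφt : ¬ (φ 0).Realize (Sum.elim (fun x => (i x : WithTop Γ')) fun _ => ⊤) := by
    intro hr
    have h1 := (Formula.realize_inf.1 hr).2
    rw [Formula.realize_equal, realize_psi, realize_sub] at h1
    exact absurd h1.symm WithTop.coe_ne_top
  obtain ⟨z, hz⟩ := hsat φ fun F => by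
    obtain ⟨x, hx⟩ := hi.isLogSubspace.exists_approx h hΨ hα F
    refine ⟨i x, fun y hy => (hφ y _).2 ⟨?_, ?_⟩⟩
    · obtain ⟨h1, h2⟩ := hx y hy
      split_ifs with hlt
      · exact (hi.lt_iff y x).1 (h2.2 hlt)
      -- Equality is impossible, since `ψ (x - y) = ψ (α - y)` is finite.
      · refine (hi.lt_iff x y).1 (lt_of_le_of_ne (not_lt.1 (mt h2.1 hlt)) fun e => ?_)
        rw [e, sub_self, h.psi_zero, hc] at h1
        exact WithTop.coe_ne_top h1.symm
    · rw [← map_sub]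
      exact hi.map_psi _ _ ((hx y hy).1.trans (hc y))
  induction z using WithTop.recTopCoe with
  | top => exact absurd (hz 0) hφt
  | coe z =>
    refine ⟨z, fun x => ?_, fun x => ⟨c x, hc x, ((hφ x z).1 (hz x)).2⟩⟩
    have h1 := ((hφ x z).1 (hz x)).1
    split_ifs at h1 with hlt
    · exact iff_of_true hlt h1
    · exact iff_of_false hlt h1.not_gt

/-- A partial embedding whose domain is not the whole couple has a proper extension. -/
theorem IsLogEmbedding.exists_parallel (h : IsLogCouple ψ) (h' : IsLogCouple ψ')
    (hi : IsLogEmbedding ψ ψ' D i) (hsat : RealizesTypes ψ' i) (hD : D ≠ ⊤) :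
    ∃ (W : Type u) (_ : AddCommGroup W) (_ : Module ℚ W) (Φ : W →ₗ[ℚ] Γ) (Φ' : W →ₗ[ℚ] Γ'),
      IsParallel ψ ψ' Φ Φ' ∧ (∃ w, Φ w ∉ D) ∧ ∀ x : D, ∃ w, Φ w = x ∧ Φ' w = i x := by
  by_cases hΨ : ∀ b ∈ finPsi ψ, b ∈ D
  · obtain ⟨α, -, hα⟩ := SetLike.exists_of_lt (lt_top_iff_ne_top.2 hD)
    obtain ⟨α', h1, h2⟩ := hi.exists_type h hsat hΨ hα
    refine ⟨D × ℚ, inferInstance, inferInstance, _, _,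
      isParallel_of_finPsi_subset h h' hi hΨ h1 h2, ⟨(0, 1), ?_⟩, fun x => ⟨(x, 0), ?_, ?_⟩⟩
    · simpa using hα
    · simp
    · simp
  · push Not at hΨ
    obtain ⟨b, hb, hbD⟩ := hΨ
    obtain ⟨b', hb', hcut⟩ := hi.exists_cut h hsat hb hbD
    have hne : ∀ x : D, (x : Γ) ≠ b := fun x e => hbD (e ▸ x.2)
    -- All inequalities of the cut are strict, so `b'` differs from every `i x`.
    have hbD' : b' ∉ LinearMap.range i := by
      rintro ⟨x, e⟩
      rcases lt_or_gt_of_ne (hne x) with hlt | hlt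
      · exact ((hcut x).1 hlt).ne e
      · exact ((hcut x).2 hlt).ne' e
    obtain ⟨B, hB, rfl⟩ := hi.isLogSubspace.exists_chain h hb hbD
    obtain ⟨B', hB', rfl⟩ := hi.isLogSubspace_range.exists_chain h' hb' hbD'
    have hp : ChainPair ψ ψ' D i B B' := ⟨hB, hB', fun x => by
      rcases lt_or_gt_of_ne (hne x) with hlt | hlt
      · exact iff_of_true hlt ((hcut x).1 hlt)
      · exact iff_of_false hlt.not_gt ((hcut x).2 hlt).not_gt⟩
    refine ⟨D × (ℤ →₀ ℚ), inferInstance, inferInstance, _, _, hp.isParallel h h' hi,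
      ⟨(0, Finsupp.single 0 1), ?_⟩, fun x => ⟨(x, 0), ?_, ?_⟩⟩
    · rwa [chainMap_inr]
    · rw [chainMap_inl]
      rfl
    · rw [chainMap_inl]

end Extension

/-! ### From structures to couples and back -/

section Structures

open FirstOrder.Language FirstOrder.Language.Structure

variable {Γ : Type u} [AddCommGroup Γ] [LinearOrder Γ] [IsOrderedAddMonoid Γ] [Module ℚ Γ]
  {Γ' : Type v} [AddCommGroup Γ'] [LinearOrder Γ'] [IsOrderedAddMonoid Γ'] [Module ℚ Γ']
  {ψ' : Γ' → WithTop Γ'} {ψ : Γ → WithTop Γ}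

theorem divBy_coe (n : ℕ+) (x : Γ) :
    divBy n (x : WithTop Γ) = (((n : ℚ)⁻¹ • x : Γ) : WithTop Γ) := by
  apply divBy_eq
  rw [← Nat.cast_smul_eq_nsmul ℚ, smul_smul, mul_inv_cancel₀ (by exact_mod_cast n.ne_zero),
    one_smul]

/-- The finite part of a substructure is a subspace, and an embedding of the substructure is an
embedding of the subspace. -/
theorem exists_logEmbedding (h : IsLogCouple ψ) (h' : IsLogCouple ψ') :
    letI := coupleStructure ψ
    letI := coupleStructure ψ'
    ∀ (M₀ : Llog.Substructure (WithTop Γ)) (i : M₀ ↪[Llog] WithTop Γ'),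
      ∃ (D : Submodule ℚ Γ) (f : D →ₗ[ℚ] Γ'), IsLogEmbedding ψ ψ' D f ∧
        (∀ x : Γ, x ∈ D ↔ (x : WithTop Γ) ∈ M₀) ∧ (∀ hx : ⊤ ∈ M₀, i ⟨⊤, hx⟩ = ⊤) ∧
        ∀ (x : D) (hx : ((x : Γ) : WithTop Γ) ∈ M₀), i ⟨((x : Γ) : WithTop Γ), hx⟩ = f x := by
  let := coupleStructure ψ
  let := coupleStructure ψ'
  intro M₀ i
  have top_mem : (⊤ : WithTop Γ) ∈ M₀ :=
    M₀.fun_mem (LogFunc.infty : Llog.Functions 0) Fin.elim0 (fun k => k.elim0)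
  have zero_mem : ((0 : Γ) : WithTop Γ) ∈ M₀ :=
    M₀.fun_mem (LogFunc.zero : Llog.Functions 0) Fin.elim0 (fun k => k.elim0)
  have neg_mem : ∀ x : Γ, (x : WithTop Γ) ∈ M₀ → ((-x : Γ) : WithTop Γ) ∈ M₀ := fun x hx =>
    M₀.fun_mem (LogFunc.neg : Llog.Functions 1) (fun _ => x) (fun _ => hx)
  have psi_mem : ∀ x : Γ, (x : WithTop Γ) ∈ M₀ → ψ x ∈ M₀ := fun x hx =>
    M₀.fun_mem (LogFunc.psi : Llog.Functions 1) (fun _ => x) (fun _ => hx)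
  have succ_mem : ∀ x : Γ, (x : WithTop Γ) ∈ M₀ → succ ψ x ∈ M₀ := fun x hx =>
    M₀.fun_mem (LogFunc.succ : Llog.Functions 1) (fun _ => x) (fun _ => hx)
  have pred_mem : ∀ x : Γ, (x : WithTop Γ) ∈ M₀ → pred ψ x ∈ M₀ := fun x hx =>
    M₀.fun_mem (LogFunc.pred : Llog.Functions 1) (fun _ => x) (fun _ => hx)
  have div_mem : ∀ (n : ℕ+) (x : Γ), (x : WithTop Γ) ∈ M₀ →
      (((n : ℚ)⁻¹ • x : Γ) : WithTop Γ) ∈ M₀ := fun n x hx => by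
    rw [← divBy_coe]
    exact M₀.fun_mem (LogFunc.delta n : Llog.Functions 1) (fun _ => x) (fun _ => hx)
  have add_mem : ∀ x y : Γ, (x : WithTop Γ) ∈ M₀ → (y : WithTop Γ) ∈ M₀ →
      ((x + y : Γ) : WithTop Γ) ∈ M₀ := fun x y hx hy =>
    M₀.fun_mem (LogFunc.add : Llog.Functions 2) ![x, y] (fun k => by fin_cases k <;> assumption)
  let G : AddSubgroup Γ :=
    { carrier := {x | (x : WithTop Γ) ∈ M₀}
      zero_mem' := zero_mem
      add_mem' := fun {x y} hx hy => add_mem x y hx hy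
      neg_mem' := fun {x} hx => neg_mem x hx }
  let D : Submodule ℚ Γ :=
    { G with
      smul_mem' := fun q x hx => by
        have h1 : ((q.den : ℚ)⁻¹ • x : Γ) ∈ G := div_mem ⟨q.den, q.den_pos⟩ x hx
        have h2 := G.zsmul_mem h1 q.num
        rwa [← Int.cast_smul_eq_zsmul ℚ, smul_smul, ← div_eq_mul_inv, Rat.num_div_den] at h2 }
  have i_top : i ⟨⊤, top_mem⟩ = ⊤ := by
    refine (congrArg i (Subtype.ext ?_)).trans
      (i.map_fun (LogFunc.infty : Llog.Functions 0) Fin.elim0)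
    rfl
  have i_fin : ∀ x : D, ∃ y : Γ', i ⟨(x : Γ), x.2⟩ = y := fun x => by
    obtain ⟨y, hy⟩ := WithTop.ne_top_iff_exists.1
      (show i ⟨((x : Γ) : WithTop Γ), x.2⟩ ≠ ⊤ from fun e => by
        rw [← i_top] at e
        exact WithTop.coe_ne_top (congrArg Subtype.val (i.injective e)))
    exact ⟨y, hy.symm⟩
  choose g hg using i_fin
  have g_add : ∀ x y : D, g (x + y) = g x + g y := fun x y => by
    have h1 := i.map_fun (LogFunc.add : Llog.Functions 2) ![⟨(x : Γ), x.2⟩, ⟨(y : Γ), y.2⟩]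
    have h2 : i ⟨((x + y : D) : Γ), (x + y).2⟩ = i ⟨(x : Γ), x.2⟩ + i ⟨(y : Γ), y.2⟩ := h1
    rw [hg, hg, hg] at h2
    exact_mod_cast h2
  let f : D →ₗ[ℚ] Γ' := (AddMonoidHom.mk' g g_add).toRatLinearMap
  have hf : ∀ x : D, i ⟨(x : Γ), x.2⟩ = f x := hg
  have i_psi : ∀ x : D, i ⟨ψ x, psi_mem x x.2⟩ = ψ' (f x) := fun x =>
    (i.map_fun (LogFunc.psi : Llog.Functions 1) fun _ => ⟨(x : Γ), x.2⟩).trans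
      (congrArg (extendTop ψ') (hf x))
  have i_succ : ∀ x : D, i ⟨succ ψ (x : Γ), succ_mem x x.2⟩ = succ ψ' (f x) := fun x =>
    (i.map_fun (LogFunc.succ : Llog.Functions 1) fun _ => ⟨(x : Γ), x.2⟩).trans
      (congrArg (succ ψ') (hf x))
  have i_pred : ∀ x : D, i ⟨pred ψ (x : Γ), pred_mem x x.2⟩ = pred ψ' (f x) := fun x =>
    (i.map_fun (LogFunc.pred : Llog.Functions 1) fun _ => ⟨(x : Γ), x.2⟩).trans
      (congrArg (pred ψ') (hf x))
  have i_lt : ∀ x y : M₀, i x < i y ↔ (x : WithTop Γ) < y := fun x y =>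
    i.map_rel (LogRel.lt : Llog.Relations 2) ![x, y]
  have mem_range : ∀ (z : M₀) (c : Γ'), i z = c → c ∈ LinearMap.range f := by
    rintro ⟨z, hz⟩ c e
    induction z using WithTop.recTopCoe with
    | top =>
      rw [i_top] at e
      exact absurd e.symm WithTop.coe_ne_top
    | coe z => exact ⟨⟨z, hz⟩, WithTop.coe_injective ((hf ⟨z, hz⟩).symm.trans e)⟩
  refine ⟨D, f, ⟨⟨fun x hx c e => ?_, fun x hx => ?_, fun x hx hxD => ?_⟩, ⟨?_, ?_, ?_⟩,
    fun x => ?_, fun x c e => ?_⟩, fun x => Iff.rfl, fun _ => i_top, fun x _ => hf x⟩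
  · change (c : WithTop Γ) ∈ M₀
    rw [← e]
    exact psi_mem x hx
  · change ((finSucc ψ x : Γ) : WithTop Γ) ∈ M₀
    rw [← h.coe_finSucc]
    exact succ_mem x hx
  · change (x : WithTop Γ) ∈ M₀
    rw [← h.pred_eq_coe hx rfl]
    exact pred_mem _ hxD
  · rintro _ ⟨x, rfl⟩ c e
    exact mem_range _ c ((i_psi x).trans e)
  · rintro _ ⟨x, rfl⟩
    exact mem_range _ _ ((i_succ x).trans (h'.coe_finSucc _))
  · rintro y hy ⟨x, e⟩
    exact mem_range _ _ ((i_pred x).trans (h'.pred_eq_coe hy e.symm))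
  · have h1 := i_lt ⟨((0 : D) : Γ), zero_mem⟩ ⟨(x : Γ), x.2⟩
    rw [hf x, hf 0, map_zero] at h1
    exact ⟨fun h2 => WithTop.coe_lt_coe.1 (h1.2 (WithTop.coe_lt_coe.2 h2)),
      fun h2 => WithTop.coe_lt_coe.1 (h1.1 (WithTop.coe_lt_coe.2 h2))⟩
  · rw [← i_psi, ← hf]
    exact congrArg i (Subtype.ext e)

variable {W : Type w} [AddCommGroup W] [Module ℚ W] {Φ' : W →ₗ[ℚ] Γ'} {Φ : W →ₗ[ℚ] Γ}

/-- Both images are parametrized by `W ∪ {∞}`, and each operation leads to the same parameter on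
both sides; for `p` this includes the default value `∞`. -/
theorem IsParallel.exists_funMap (h : IsLogCouple ψ) (h' : IsLogCouple ψ')
    (hp : IsParallel ψ ψ' Φ Φ') :
    letI := coupleStructure ψ
    letI := coupleStructure ψ'
    ∀ (n : ℕ) (f : Llog.Functions n) (t : Fin n → WithTop W),
      ∃ r : WithTop W, funMap f (fun k => (t k).map Φ) = r.map Φ ∧
        funMap f (fun k => (t k).map Φ') = r.map Φ' := by
  let := coupleStructure ψ
  let := coupleStructure ψ'
  intro n f t
  cases f with
  | zero => exact ⟨(0 : W), congrArg _ (map_zero Φ).symm, congrArg _ (map_zero Φ').symm⟩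
  | infty => exact ⟨⊤, rfl, rfl⟩
  | neg =>
    change ∃ r : WithTop W, extendTop (fun α => ((-α : Γ) : WithTop Γ)) ((t 0).map Φ) = r.map Φ ∧
      extendTop (fun α => ((-α : Γ') : WithTop Γ')) ((t 0).map Φ') = r.map Φ'
    generalize t 0 = w
    induction w using WithTop.recTopCoe with
    | top => exact ⟨⊤, rfl, rfl⟩
    | coe w => exact ⟨(-w : W), congrArg _ (map_neg Φ w).symm, congrArg _ (map_neg Φ' w).symm⟩
  | psi =>
    change ∃ r : WithTop W, extendTop ψ ((t 0).map Φ) = r.map Φ ∧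
      extendTop ψ' ((t 0).map Φ') = r.map Φ'
    generalize t 0 = w
    induction w using WithTop.recTopCoe with
    | top => exact ⟨⊤, rfl, rfl⟩
    | coe w =>
      rcases eq_or_ne w 0 with rfl | hw
      · refine ⟨⊤, ?_, ?_⟩
        · rw [WithTop.map_coe, map_zero, extendTop_coe, h.psi_zero, WithTop.map_top]
        · rw [WithTop.map_coe, map_zero, extendTop_coe, h'.psi_zero, WithTop.map_top]
      · obtain ⟨u, hu⟩ := hp.agree w hw
        exact ⟨u, hu.left, hu.right⟩
  | succ =>
    change ∃ r : WithTop W, LogCouple.succ ψ ((t 0).map Φ) = r.map Φ ∧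
      LogCouple.succ ψ' ((t 0).map Φ') = r.map Φ'
    generalize t 0 = w
    induction w using WithTop.recTopCoe with
    | top => exact ⟨⊤, rfl, rfl⟩
    | coe w =>
      obtain ⟨u, hu⟩ := hp.succ w
      exact ⟨u, (h.coe_finSucc _).trans (congrArg _ hu),
        (h'.coe_finSucc _).trans (congrArg _ (hp.map_succ h h' hu))⟩
  | pred =>
    change ∃ r : WithTop W, LogCouple.pred ψ ((t 0).map Φ) = r.map Φ ∧
      LogCouple.pred ψ' ((t 0).map Φ') = r.map Φ'
    generalize t 0 = w
    induction w using WithTop.recTopCoe with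
    | top => exact ⟨⊤, h.pred_top, h'.pred_top⟩
    | coe w =>
      rcases hp.pred_cases h h' w with ⟨u, h1, h2⟩ | ⟨h1, h2⟩
      · exact ⟨u, h1, h2⟩
      · exact ⟨⊤, h1, h2⟩
  | delta m =>
    change ∃ r : WithTop W, divBy m ((t 0).map Φ) = r.map Φ ∧ divBy m ((t 0).map Φ') = r.map Φ'
    generalize t 0 = w
    induction w using WithTop.recTopCoe with
    | top => exact ⟨⊤, rfl, rfl⟩
    | coe w =>
      refine ⟨((m : ℚ)⁻¹ • w : W), ?_, ?_⟩ <;>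
        rw [WithTop.map_coe, WithTop.map_coe, divBy_coe, map_smul]
  | add =>
    change ∃ r : WithTop W, (t 0).map Φ + (t 1).map Φ = r.map Φ ∧
      (t 0).map Φ' + (t 1).map Φ' = r.map Φ'
    exact ⟨t 0 + t 1, (WithTop.map_add Φ _ _).symm, (WithTop.map_add Φ' _ _).symm⟩

theorem IsParallel.map_lt_map_iff (hp : IsParallel ψ ψ' Φ Φ') (x y : WithTop W) :
    x.map Φ < y.map Φ ↔ x.map Φ' < y.map Φ' := by
  induction x using WithTop.recTopCoe with
  | top => exact iff_of_false not_top_lt not_top_lt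
  | coe x =>
    induction y using WithTop.recTopCoe with
    | top => exact iff_of_true (WithTop.coe_lt_top _) (WithTop.coe_lt_top _)
    | coe y =>
      simp only [WithTop.map_coe, WithTop.coe_lt_coe]
      exact hp.lt_iff x y

end Structures

end LogCouple

end

/-! ### The extension theorem for structures -/

theorem mainTheorem1 {M₁ N : Type*} [LogCouple.Llog.Structure M₁] [LogCouple.Llog.Structure N]
    (hM₁ : M₁ ⊨ LogCouple.Tlog) (hN : N ⊨ LogCouple.Tlog)
    (M₀ : LogCouple.Llog.Substructure M₁) (hM₀ : M₀ ⊨ LogCouple.Tlog) (hne : M₀ ≠ ⊤)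
    (hsat : LogCouple.IsSaturated LogCouple.Llog N (Order.succ #M₁))
    (i : M₀ ↪[LogCouple.Llog] N) :
    ∃ α : M₁, α ∉ M₀ ∧
      ∃ (M : LogCouple.Llog.Substructure M₁) (hM : M₀ ≤ M),
        M ⊨ LogCouple.Tlog ∧ α ∈ M ∧
          ∃ j : M ↪[LogCouple.Llog] N,
            ∀ x : M₀, j (FirstOrder.Language.Substructure.inclusion hM x) = i x := by
  obtain ⟨Γ, _, _, _, ψ, h, ⟨e⟩⟩ := (LogCouple.models_Tlog_iff M₁).1 hM₁
  obtain ⟨Γ', _, _, _, ψ', h', ⟨e'⟩⟩ := (LogCouple.models_Tlog_iff N).1 hN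
  let := LogCouple.coupleStructure ψ
  let := LogCouple.coupleStructure ψ'
  let := LogCouple.ratModule h.divisible
  let := LogCouple.ratModule h'.divisible
  let E := e.toEmbedding.substructureEquivMap M₀
  obtain ⟨D, f, hf, hD, hftop, hfi⟩ := LogCouple.exists_logEmbedding h h'
    (M₀.map e.toEmbedding.toHom) ((e'.toEmbedding.comp i).comp E.symm.toEmbedding)
  have mem_map : ∀ x : M₁, e x ∈ M₀.map e.toEmbedding.toHom ↔ x ∈ M₀ := fun x => by
    constructor
    · rintro ⟨y, hy, hyx⟩
      rwa [← e.injective hyx]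
    · exact fun hx => ⟨x, hx, rfl⟩
  have i_eq : ∀ (x : M₀) (hx : e x ∈ M₀.map e.toEmbedding.toHom),
      ((e'.toEmbedding.comp i).comp E.symm.toEmbedding) ⟨e x, hx⟩ = e' (i x) := fun x hx => by
    have h1 : E.symm ⟨e x, hx⟩ = x := E.symm_apply_apply x
    change e' (i (E.symm ⟨e x, hx⟩)) = _
    rw [h1]
  -- The parameters are indexed by `D`, which injects into `M₁`, so the saturation hypothesis
  -- applies.
  have hcard : #D < Order.succ #M₁ := Order.lt_succ_of_le <|
    mk_le_of_injective (f := fun x : D => e.symm ((x : Γ) : WithTop Γ)) fun x y hxy =>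
      Subtype.ext (WithTop.coe_injective (e.symm.injective hxy))
  have hDne : D ≠ ⊤ := by
    rintro rfl
    refine hne (eq_top_iff.2 fun x _ => ?_)
    rw [← mem_map]
    cases hx : e x using WithTop.recTopCoe with
    | top =>
      exact (M₀.map e.toEmbedding.toHom).fun_mem
        (LogCouple.LogFunc.infty : LogCouple.Llog.Functions 0) Fin.elim0 (fun k => k.elim0)
    | coe x => exact (hD x).1 trivial
  obtain ⟨W, _, _, Φ, Φ', hp, ⟨w, hw⟩, hext⟩ := hf.exists_parallel h h'
    (fun φ hφ => hsat.exists_realize e' hcard _ φ hφ) hDne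
  obtain ⟨S, hS, j, hj⟩ := LogCouple.exists_embedding_of_agree (L := LogCouple.Llog)
    (fun t : WithTop W => e.symm (t.map Φ)) (fun t => e'.symm (t.map Φ'))
    (fun n g t => by
      obtain ⟨r, h1, h2⟩ := hp.exists_funMap h h' n g t
      exact ⟨r, (e.symm.map_fun g _).symm.trans (congrArg _ h1),
        (e'.symm.map_fun g _).symm.trans (congrArg _ h2)⟩)
    (fun n R t => by
      refine (e.symm.map_rel R fun k => (t k).map Φ).trans
        (Iff.trans ?_ (e'.symm.map_rel R fun k => (t k).map Φ').symm)
      cases R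
      exact hp.map_lt_map_iff (t 0) (t 1))
    (e.symm.injective.comp (Option.map_injective (hp.injective h)))
    (e'.symm.injective.comp (Option.map_injective (hp.injective_right h')))
  -- Every element of `M₀` has a parameter in `W ∪ {∞}` whose second image is its image under `i`;
  -- this gives both `M₀ ≤ S` and that `j` extends `i`.
  have cover : ∀ x : M₀, ∃ t : WithTop W, e.symm (t.map Φ) = x ∧ e'.symm (t.map Φ') = i x := by
    intro x
    have hx := (mem_map x).2 x.2
    have h1 := i_eq x hx
    rw [← e.symm_apply_apply (x : M₁), ← e'.symm_apply_apply (i x), ← h1]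
    generalize e x = y at hx
    induction y using WithTop.recTopCoe with
    | top =>
      rw [hftop hx]
      exact ⟨⊤, rfl, rfl⟩
    | coe y =>
      rw [hfi ⟨y, (hD y).2 hx⟩ hx]
      obtain ⟨t, h2, h3⟩ := hext ⟨y, (hD y).2 hx⟩
      exact ⟨t, congrArg (fun z : Γ => e.symm (z : WithTop Γ)) h2,
        congrArg (fun z : Γ' => e'.symm (z : WithTop Γ')) h3⟩
  have hM : M₀ ≤ S := fun x hx => by
    obtain ⟨t, ht, -⟩ := cover ⟨x, hx⟩
    have h1 : e.symm (t.map Φ) ∈ S := hS t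
    rwa [ht] at h1
  -- `S` is a model because `Tlog` is universal.
  refine ⟨e.symm (Φ w : WithTop Γ), fun hmem => hw ?_, S, hM, inferInstance, hS w, j, fun x => ?_⟩
  · rw [hD, ← e.apply_symm_apply (Φ w : WithTop Γ)]
    exact (mem_map _).2 hmem
  · obtain ⟨t, ht, ht'⟩ := cover x
    rw [← ht', ← hj t (hS t)]
    exact congrArg j (Subtype.ext ht.symm)
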